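/- Let $\mathbb T$ be the set of isomorphism classes of finite non-empty rooted trees (without a planar structure), $|t|$ the number of vertices of $t$, and $\bullet$ the tree with one vertex. For $v\in V(s)$ let $s\cup_v t$ be the rooted tree obtained by joining the root of $t$ to the vertex $v$ of $s$ by a new edge. For an edge $e$ of $t$ let $R_e(t)$ and $P_e(t)$ be the rooted trees into which cutting $e$ divides $t$, with $R_e(t)$ containing the root of $t$. Put $$\nu(p,q;t)=\#\{v\in V(p): p\cup_v q=t\},\qquad \kappa(p,q;t)=\#\{e\in E(t): R_e(t)=p,\ P_e(t)=q\}.$$ Let $\mathfrak g$ be the complex Lie algebra with generators $D^+_t, D^-_t, d$ $(t\in\mathbb T)$ and relations $$[D^+_{t_1},D^+_{t_2}]=\sum_{v\in V(t_2)}D^+_{t_2\cup_v t_1}-\sum_{v\in V(t_1)}D^+_{t_1\cup_v t_2},$$ $$[D^-_{t_1},D^-_{t_2}]=\sum_{t}\kappa(t_1,t_2;t)D^-_t-\sum_t\kappa(t_2,t_1;t)D^-_t,$$ $$[D^-_{t_1},D^+_{t_2}]=\sum_t\kappa(t,t_1;t_2)D^+_t+\sum_t\nu(t,t_2;t_1)D^-_t\quad(t_1\ne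 t_2),$$ $$[D^-_t,D^+_t]=d,\qquad [d,D^-_t]=-|t|D^-_t,\qquad [d,D^+_t]=|t|D^+_t .$$ Let $\mathfrak n_-$ be the subalgebra generated by the $D^-_t$. The Lie algebra $\mathfrak g$ acts on the vector space $\mathcal T$ spanned by $\mathbb T$ and the empty tree $1$ by $$D^+_t(s)=\sum_{v\in V(s)}s\cup_v t,\qquad D^-_t(s)=\sum_{e\in E(s),\,P_e(s)=t}R_e(s),\qquad d(s)=|s|\,s\qquad(s\in\mathbb T),$$ and by zero on $1$. Let $M=\mathcal T/\mathbb C\cdot 1$. For a representation $V$ let $V_\delta$ be the $\delta$-eigenspace of $d$; a lowest-weight vector of weight $\delta$ is a non-zero $w\in V_\delta$ with $\mathfrak n_-w=0$. For $\lambda\in\mathbb C$ let $W(\lambda)$ be the Verma module, that is, the representation of $\mathfrak g$ induced from the one-dimensional representation of $\mathbb C d\oplus\mathfrak n_-$ on which $d$ acts by $\lambda$ and $\mathfrak n_-$ by zero; equivalently, the quotient of $U(\mathfrak g)$ by the left ideal generated by $\mathfrak n_-$ and $d-\lambda$. Let $v$ be the class of $1\in U(\mathfrak g)$ in $W(1)$.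 For a forest $F$ (a finite multiset of rooted trees) let $|F|$ be its number of vertices, and let $B(F)$ be the rooted tree obtained by adding a root and joining it to the roots of the trees of $F$. Then the following hold. 1. The class of $\bullet$ in $M$ is a lowest-weight vector of weight $1$, and for every integer $n>1$ the space $M_n$ contains no lowest-weight vector. 2. $M$ is an irreducible representation of $\mathfrak g$. 3. The vector $v$ is a lowest-weight vector of weight $1$ in $W(1)$, and there is exactly one homomorphism of representations $W(1)\to M$ sending $v$ to $\bullet$. It is an isomorphism, and it maps $W(1)_n$ onto $M_n$ for every integer $n\ge 0$. 4. Fix any total order on $\mathbb T$ and put $D^+_Fv=D^+_{t_k}\cdots D^+_{t_1}v$ for a forest $F$ with trees $t_1\le\dots\le t_k$. For every integer $n\ge0$, the vectors $D^+_Fv$ with $|F|=n-1$ form a basis of $W(1)_n$; the classes of the trees with $n$ vertices form a basis of $M_n$; and $B$ is a bijection from the forests on $n-1$ vertices to the rooted trees on $n$ vertices. Moreover $D^+_Fv\mapsto B(F)$ defines a linear isomorphism $W(1)\to M$ which maps $W(1)_n$ onto $M_n$ for every $n$. 5. $W(1)$ is irreducible. -/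

import Mathlib

namespace InsertionElimination

/-! ### Rooted trees -/

/-- Rooted trees drawn in the plane. `vertex` is the tree with one vertex; `join a t` is obtained
from the disjoint union of `a` and `t` by joining the root of `a` to the root of `t` by a new edge,
so that `a` becomes the first branch at the root, and the root is that of `t`. Every finite rooted
planar tree with at least two vertices is `join a t` for exactly one pair `(a, t)`. -/
inductive PlanarTree : Type
  | vertex : PlanarTree
  | join (a t : PlanarTree) : PlanarTree

/-- Isomorphism of the underlying rooted trees: the equivalence relation generated by interchanging
two consecutive branches at some vertex. -/
inductive PlanarTree.Iso : PlanarTree → PlanarTree → Prop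
  | refl (t : PlanarTree) : Iso t t
  | symm {s t : PlanarTree} : Iso s t → Iso t s
  | trans {s t u : PlanarTree} : Iso s t → Iso t u → Iso s u
  | join {a b s t : PlanarTree} : Iso a b → Iso s t → Iso (.join a s) (.join b t)
  | swap (a b t : PlanarTree) : Iso (.join a (.join b t)) (.join b (.join a t))

instance PlanarTree.setoid : Setoid PlanarTree where
  r := PlanarTree.Iso
  iseqv := ⟨PlanarTree.Iso.refl, PlanarTree.Iso.symm, PlanarTree.Iso.trans⟩

/-- (Isomorphism classes of) finite non-empty rooted trees. -/
def RTree : Type := Quotient PlanarTree.setoid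

namespace RTree

noncomputable instance : DecidableEq RTree := Classical.decEq _

/-- The rooted tree `•` with one vertex. -/
def vertex : RTree := Quotient.mk _ PlanarTree.vertex

/-- The tree obtained by joining the root of `a` to the root of `t` by a new edge; its root is that
of `t`. -/
def join (a t : RTree) : RTree :=
  Quotient.map₂ PlanarTree.join (fun _ _ h _ _ h' => PlanarTree.Iso.join h h') a t

theorem join_left_comm (a b t : RTree) : join a (join b t) = join b (join a t) := by
  induction a using Quotient.inductionOn
  induction b using Quotient.inductionOn
  induction t using Quotient.inductionOn
  exact Quotient.sound (PlanarTree.Iso.swap _ _ _)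

instance : LeftCommutative join := ⟨join_left_comm⟩

@[elab_as_elim]
theorem ind {P : RTree → Prop} (h1 : P vertex) (h2 : ∀ a t, P a → P t → P (join a t))
    (t : RTree) : P t := by
  induction t using Quotient.inductionOn with
  | h t =>
    induction t with
    | vertex => exact h1
    | join a t iha iht => exact h2 _ _ iha iht

/-- Functions on rooted trees by recursion on `join`. -/
def planarRec {X : Type} (x : X) (f : RTree → RTree → X → X → X) : PlanarTree → X
  | .vertex => x
  | .join a t => f (Quotient.mk _ a) (Quotient.mk _ t) (planarRec x f a) (planarRec x f t)

theorem planarRec_iso {X : Type} (x : X) (f : RTree → RTree → X → X → X)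
    (hf : ∀ a b t x y z, f a (join b t) x (f b t y z) = f b (join a t) y (f a t x z))
    {s t : PlanarTree} (h : PlanarTree.Iso s t) : planarRec x f s = planarRec x f t := by
  induction h with
  | refl => rfl
  | symm _ ih => exact ih.symm
  | trans _ _ ih ih' => exact ih.trans ih'
  | join h h' ih ih' =>
    simp only [planarRec, ih, ih']
    rw [Quotient.sound (s := PlanarTree.setoid) h, Quotient.sound (s := PlanarTree.setoid) h']
  | swap a b t => exact hf (Quotient.mk _ a) (Quotient.mk _ b) (Quotient.mk _ t) _ _ _

/-- The function `F` with `F • = x` and `F (join a t) = f a t (F a) (F t)`. -/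
def recur {X : Type} (x : X) (f : RTree → RTree → X → X → X)
    (hf : ∀ a b t x y z, f a (join b t) x (f b t y z) = f b (join a t) y (f a t x z)) :
    RTree → X :=
  Quotient.lift (planarRec x f) (fun _ _ h => planarRec_iso x f hf h)

/-- The number `|t|` of vertices of `t`. -/
def size : RTree → ℕ :=
  recur 1 (fun _ _ m n => m + n) (by intros; omega)

/-- The multiset of the trees `t ∪_v q`, where `v` runs over the vertices of `t`. Here `t ∪_v q` is
obtained by joining the root of `q` to the vertex `v` of `t` by a new edge. The vertices of
`join a t` are those of `a` and those of `t`. -/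
def graft (q : RTree) : RTree → Multiset RTree :=
  recur {join q vertex} (fun a t A B => A.map (fun x => join x t) + B.map (fun y => join a y))
    (by
      intro a b t x y z
      simp only [Multiset.map_add, Multiset.map_map, Function.comp_def]
      rw [add_left_comm]
      simp only [join_left_comm])

/-- The multiset of the pairs `(R_e(t), P_e(t))`, where `e` runs over the edges of `t`. Here
`P_e(t)` is the component not containing the root, and `R_e(t)` the component containing the root,
of the result of cutting the edge `e`. The edges of `join a t` are the new edge, those of `a`, and
those of `t`. -/
def cuts : RTree → Multiset (RTree × RTree) :=
  recur 0 (fun a t A B =>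
      (t, a) ::ₘ (A.map (fun c => (join c.1 t, c.2)) + B.map (fun c => (join a c.1, c.2))))
    (by
      intro a b t x y z
      have h1 : ∀ c, join c (join b t) = join b (join c t) := fun c => join_left_comm _ _ _
      have h2 : ∀ c, join c (join a t) = join a (join c t) := fun c => join_left_comm _ _ _
      have h3 : ∀ c, join a (join b c) = join b (join a c) := fun c => join_left_comm _ _ _
      simp only [Multiset.map_add, Multiset.map_map, Function.comp_def,
        ← Multiset.singleton_add, Multiset.map_singleton, h1, h2, h3]
      abel)

theorem size_vertex : size vertex = 1 := rfl

theorem size_join (a t : RTree) : size (join a t) = size a + size t := by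
  induction a using Quotient.inductionOn
  induction t using Quotient.inductionOn
  rfl

theorem graft_vertex (q : RTree) : graft q vertex = {join q vertex} := rfl

theorem graft_join (q a t : RTree) : graft q (join a t) =
    (graft q a).map (fun x => join x t) + (graft q t).map (fun y => join a y) := by
  induction a using Quotient.inductionOn
  induction t using Quotient.inductionOn
  rfl

theorem cuts_vertex : cuts vertex = 0 := rfl

theorem cuts_join (a t : RTree) : cuts (join a t) =
    (t, a) ::ₘ ((cuts a).map (fun c => (join c.1 t, c.2)) +
      (cuts t).map (fun c => (join a c.1, c.2))) := by
  induction a using Quotient.inductionOn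
  induction t using Quotient.inductionOn
  rfl

theorem mem_cuts_iff (u p q : RTree) : (p, q) ∈ cuts u ↔ u ∈ graft q p := by
  constructor
  · induction u using ind generalizing p q with
    | h1 => simp [cuts_vertex]
    | h2 a t iha iht =>
      rw [cuts_join]
      simp only [Multiset.mem_cons, Multiset.mem_add, Multiset.mem_map, Prod.mk.injEq, Prod.exists]
      rintro (⟨rfl, rfl⟩ | ⟨x, y, h, rfl, rfl⟩ | ⟨x, y, h, rfl, rfl⟩)
      · clear iha iht
        induction p using ind with
        | h1 => simp [graft_vertex]
        | h2 b p _ ih =>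
          rw [graft_join, Multiset.mem_add, Multiset.mem_map, Multiset.mem_map]
          exact Or.inr ⟨_, ih, join_left_comm _ _ _⟩
      · rw [graft_join, Multiset.mem_add, Multiset.mem_map, Multiset.mem_map]
        exact Or.inl ⟨_, iha _ _ h, rfl⟩
      · rw [graft_join, Multiset.mem_add, Multiset.mem_map, Multiset.mem_map]
        exact Or.inr ⟨_, iht _ _ h, rfl⟩
  · induction p using ind generalizing u with
    | h1 => simp +contextual [graft_vertex, cuts_join]
    | h2 a t iha iht =>
      rw [graft_join, Multiset.mem_add, Multiset.mem_map, Multiset.mem_map]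
      rintro (⟨x, h, rfl⟩ | ⟨x, h, rfl⟩)
      · rw [cuts_join]
        refine Multiset.mem_cons_of_mem (Multiset.mem_add.2 (Or.inl ?_))
        exact Multiset.mem_map.2 ⟨_, iha _ h, rfl⟩
      · rw [cuts_join]
        refine Multiset.mem_cons_of_mem (Multiset.mem_add.2 (Or.inr ?_))
        exact Multiset.mem_map.2 ⟨_, iht _ h, rfl⟩

theorem size_pos (t : RTree) : 0 < size t := by
  induction t using ind with
  | h1 => simp [size_vertex]
  | h2 a t iha iht => rw [size_join]; omega

theorem size_of_mem_graft {u p q : RTree} (h : u ∈ graft q p) : size u = size p + size q := by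
  induction p using ind generalizing u with
  | h1 =>
    rw [graft_vertex, Multiset.mem_singleton] at h
    rw [h, size_join, add_comm]
  | h2 a t iha iht =>
    rw [graft_join, Multiset.mem_add, Multiset.mem_map, Multiset.mem_map] at h
    obtain ⟨x, h, rfl⟩ | ⟨x, h, rfl⟩ := h
    · rw [size_join, size_join, iha h]; omega
    · rw [size_join, size_join, iht h]; omega

theorem card_graft (q p : RTree) : (graft q p).card = size p := by
  induction p using ind with
  | h1 => simp [graft_vertex, size_vertex]
  | h2 a t iha iht => simp [graft_join, size_join, iha, iht]

private theorem comb {A : Type} [AddCancelCommMonoid A] {l r z w x y : A} (h : l = r) (h' : z = w)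
    (e : x + (r + w) = y + (l + z)) : x = y := by
  rw [h, h'] at e
  exact add_right_cancel e

/-- Grafting `t₂` and then `t₁`: the part in which `t₁` is not grafted on `t₂` is symmetric. -/
theorem graft_graft (t₁ t₂ s : RTree) :
    (graft t₂ s).bind (graft t₁) + (graft t₂ t₁).bind (fun u => graft u s) =
      (graft t₁ s).bind (graft t₂) + (graft t₁ t₂).bind (fun u => graft u s) := by
  induction s using ind with
  | h1 =>
    simp only [graft_vertex, graft_join, Multiset.singleton_bind, Multiset.bind_singleton,
      Multiset.map_singleton, join_left_comm t₂ t₁]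
    abel
  | h2 a s iha ihs =>
    have iha' := congrArg (Multiset.map (fun x => join x s)) iha
    have ihs' := congrArg (Multiset.map (fun x => join a x)) ihs
    simp only [Multiset.map_add, Multiset.map_bind] at iha' ihs'
    have hc : ∀ q r : RTree, (graft q a).bind (fun x => (graft r s).map (fun y => join x y)) =
        (graft r s).bind (fun y => (graft q a).map (fun x => join x y)) := fun q r =>
      Multiset.bind_map_comm _ _
    simp only [graft_join, Multiset.add_bind, Multiset.bind_map, Multiset.bind_add, hc]
    exact comb iha' ihs' (by abel)

/-- The edges of `s ∪_v q` are the new edge, those of `q`, and those of `s`, and an edge of `s` has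
`v` either in the component of the root or in the other one. -/
theorem graft_cuts (q s : RTree) :
    (graft q s).bind cuts = Multiset.replicate (size s) (s, q) +
      (cuts q).bind (fun c => (graft c.1 s).map (fun x => (x, c.2))) +
      (cuts s).bind (fun c => (graft q c.1).map (fun x => (x, c.2))) +
      (cuts s).bind (fun c => (graft q c.2).map (fun x => (c.1, x))) := by
  induction s using ind with
  | h1 =>
    simp only [graft_vertex, cuts_vertex, cuts_join, Multiset.singleton_bind, size_vertex,
      Multiset.map_singleton, Multiset.map_zero, Multiset.zero_bind, Multiset.replicate_one,
      Multiset.bind_singleton, add_zero, Multiset.singleton_add]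
  | h2 a s iha ihs =>
    have iha' := congrArg (Multiset.map (fun c : RTree × RTree => (join c.1 s, c.2))) iha
    have ihs' := congrArg (Multiset.map (fun c : RTree × RTree => (join a c.1, c.2))) ihs
    simp only [Multiset.map_add, Multiset.map_bind, Multiset.map_map, Function.comp_def,
      Multiset.map_replicate] at iha' ihs'
    have hc1 : (graft q a).bind (fun x => (cuts s).map (fun c => (join x c.1, c.2))) =
        (cuts s).bind (fun c => (graft q a).map (fun x => (join x c.1, c.2))) :=
      Multiset.bind_map_comm _ _
    have hc2 : (graft q s).bind (fun x => (cuts a).map (fun c => (join c.1 x, c.2))) =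
        (cuts a).bind (fun c => (graft q s).map (fun x => (join c.1 x, c.2))) :=
      Multiset.bind_map_comm _ _
    simp only [graft_join, cuts_join, Multiset.add_bind, Multiset.bind_map, Multiset.bind_add,
      Multiset.bind_cons, Multiset.cons_bind, Multiset.map_add, Multiset.map_map,
      Function.comp_def, size_join, Multiset.replicate_add, hc1, hc2, iha', ihs']
    abel

/-- The two edges cut one after the other are either independent, or the first is cut from the
part that the second cuts off. -/
theorem cuts_cuts (s : RTree) :
    (cuts s).bind (fun c => (cuts c.1).map (fun e => (e.1, e.2, c.2))) +
      (cuts s).bind (fun c => (cuts c.2).map (fun e => (c.1, e.2, e.1))) =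
    (cuts s).bind (fun c => (cuts c.1).map (fun e => (e.1, c.2, e.2))) +
      (cuts s).bind (fun c => (cuts c.2).map (fun e => (c.1, e.1, e.2))) := by
  induction s using ind with
  | h1 => simp [cuts_vertex]
  | h2 a s iha ihs =>
    have iha' := congrArg
      (Multiset.map (fun c : RTree × RTree × RTree => (join c.1 s, c.2))) iha
    have ihs' := congrArg
      (Multiset.map (fun c : RTree × RTree × RTree => (join a c.1, c.2))) ihs
    simp only [Multiset.map_add, Multiset.map_bind, Multiset.map_map, Function.comp_def]
      at iha' ihs'
    have hc1 : (cuts a).bind (fun x => (cuts s).map (fun y => (join x.1 y.1, y.2, x.2))) =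
        (cuts s).bind (fun y => (cuts a).map (fun x => (join x.1 y.1, y.2, x.2))) :=
      Multiset.bind_map_comm _ _
    have hc2 : (cuts a).bind (fun x => (cuts s).map (fun y => (join x.1 y.1, x.2, y.2))) =
        (cuts s).bind (fun y => (cuts a).map (fun x => (join x.1 y.1, x.2, y.2))) :=
      Multiset.bind_map_comm _ _
    simp only [cuts_join, Multiset.add_bind, Multiset.bind_map, Multiset.bind_add,
      Multiset.bind_cons, Multiset.cons_bind, Multiset.map_add, Multiset.map_map,
      Multiset.map_cons, Function.comp_def, hc1, hc2]
    exact comb iha' ihs' (by abel)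

end RTree

open RTree

/-! ### The operators on the space of trees -/

/-- The vector space `𝒯` spanned by the rooted trees and the empty tree (`none`). -/
abbrev TreeSpace : Type := Option RTree →₀ ℂ

/-- The empty tree `1`, spanning the part of degree `0`. -/
noncomputable def emptyTree : TreeSpace := Finsupp.single none 1

/-- A rooted tree as an element of `𝒯`. -/
noncomputable def tree (t : RTree) : TreeSpace := Finsupp.single (some t) 1

/-- `D⁺_t s = ∑_{v ∈ V(s)} s ∪_v t`. -/
noncomputable def opPlus (t : RTree) : Module.End ℂ TreeSpace :=
  Finsupp.linearCombination ℂ fun o => match o with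
    | none => 0
    | some s => ((graft t s).map tree).sum

/-- `D⁻_t s = ∑_{e ∈ E(s), P_e(s) = t} R_e(s)`. -/
noncomputable def opMinus (t : RTree) : Module.End ℂ TreeSpace :=
  Finsupp.linearCombination ℂ fun o => match o with
    | none => 0
    | some s => (((cuts s).filter (fun c => c.2 = t)).map (fun c => tree c.1)).sum

/-- `d s = |s| s`. -/
noncomputable def opD : Module.End ℂ TreeSpace :=
  Finsupp.linearCombination ℂ fun o => match o with
    | none => 0
    | some s => (size s : ℂ) • tree s

/-! ### The Lie algebra -/

/-- The symbols `D⁺_t`, `D⁻_t`, `d`. -/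
inductive Gen : Type
  | plus (t : RTree) : Gen
  | minus (t : RTree) : Gen
  | d : Gen

/-- The number of vertices `v` of `p` with `p ∪_v q = t`. -/
noncomputable def numGraft (p q t : RTree) : ℕ := (graft q p).count t

/-- The number of edges `e` of `t` with `R_e(t) = p` and `P_e(t) = q`. -/
noncomputable def numCut (p q t : RTree) : ℕ := (cuts t).count (p, q)

local notation "F⁺" t => FreeLieAlgebra.of ℂ (Gen.plus t)
local notation "F⁻" t => FreeLieAlgebra.of ℂ (Gen.minus t)
local notation "Fd" => FreeLieAlgebra.of ℂ Gen.d

/-- The defining relations. A sum over trees `t` is restricted to a finite set of trees outside of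
which the coefficients vanish. -/
inductive Relation : FreeLieAlgebra ℂ Gen → FreeLieAlgebra ℂ Gen → Prop
  | plus_plus (t₁ t₂ : RTree) : Relation ⁅F⁺ t₁, F⁺ t₂⁆
      (((graft t₁ t₂).map fun t => F⁺ t).sum - ((graft t₂ t₁).map fun t => F⁺ t).sum)
  | minus_minus (t₁ t₂ : RTree) : Relation ⁅F⁻ t₁, F⁻ t₂⁆
      (∑ t ∈ (graft t₂ t₁).toFinset, numCut t₁ t₂ t • (F⁻ t) -
        ∑ t ∈ (graft t₁ t₂).toFinset, numCut t₂ t₁ t • (F⁻ t))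
  | minus_plus (t₁ t₂ : RTree) (h : t₁ ≠ t₂) : Relation ⁅F⁻ t₁, F⁺ t₂⁆
      (∑ t ∈ ((cuts t₂).map Prod.fst).toFinset, numCut t t₁ t₂ • (F⁺ t) +
        ∑ t ∈ ((cuts t₁).map Prod.fst).toFinset, numGraft t t₂ t₁ • (F⁻ t))
  | minus_plus_self (t : RTree) : Relation ⁅F⁻ t, F⁺ t⁆ Fd
  | d_minus (t : RTree) : Relation ⁅Fd, F⁻ t⁆ (-((size t : ℂ) • (F⁻ t)))
  | d_plus (t : RTree) : Relation ⁅Fd, F⁺ t⁆ ((size t : ℂ) • (F⁺ t))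

/-- The ideal of the free Lie algebra generated by the relations. -/
noncomputable def relationIdeal : LieIdeal ℂ (FreeLieAlgebra ℂ Gen) :=
  LieSubmodule.lieSpan ℂ _ {z | ∃ x y, Relation x y ∧ z = x - y}

/-- The insertion-elimination Lie algebra `𝔤`. -/
abbrev InsElim : Type := FreeLieAlgebra ℂ Gen ⧸ relationIdeal

/-- The generators as elements of `𝔤`. -/
noncomputable def gen (x : Gen) : InsElim := LieSubmodule.Quotient.mk (FreeLieAlgebra.of ℂ x)

/-- `D⁺_t` in `𝔤`. -/
noncomputable def Dplus (t : RTree) : InsElim := gen (Gen.plus t)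

/-- `D⁻_t` in `𝔤`. -/
noncomputable def Dminus (t : RTree) : InsElim := gen (Gen.minus t)

/-- The grading operator `d` in `𝔤`. -/
noncomputable def dElt : InsElim := gen Gen.d

/-- The Lie subalgebra `𝔫₋` generated by the `D⁻_t`. -/
noncomputable def nMinus : LieSubalgebra ℂ InsElim :=
  LieSubalgebra.lieSpan ℂ InsElim (Set.range Dminus)

/-! ### The representation on the space of trees -/

theorem opPlus_none (t : RTree) : opPlus t (Finsupp.single none 1) = 0 := by
  simp [opPlus]

theorem opMinus_none (t : RTree) : opMinus t (Finsupp.single none 1) = 0 := by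
  simp [opMinus]

theorem opD_none : opD (Finsupp.single none 1) = 0 := by
  simp [opD]

theorem opPlus_tree (t s : RTree) : opPlus t (tree s) = ((graft t s).map tree).sum := by
  simp [opPlus, tree]

theorem opMinus_tree (t s : RTree) : opMinus t (tree s) =
    ((cuts s).map (fun c => if c.2 = t then tree c.1 else 0)).sum := by
  rw [opMinus, tree, Finsupp.linearCombination_single, one_smul]
  simp only
  generalize cuts s = m
  induction m using Multiset.induction_on with
  | empty => simp
  | cons a m ih => by_cases h : a.2 = t <;> simp [h, ih]

theorem opD_tree (s : RTree) : opD (tree s) = (size s : ℂ) • tree s := by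
  simp [opD, tree]

theorem end_ext {f g : Module.End ℂ TreeSpace}
    (h0 : f (Finsupp.single none 1) = g (Finsupp.single none 1))
    (h1 : ∀ s, f (tree s) = g (tree s)) : f = g := by
  refine Finsupp.lhom_ext' fun o => LinearMap.ext_ring ?_
  cases o with
  | none => exact h0
  | some s => exact h1 s

theorem map_multiset_sum' {X : Type} (f : Module.End ℂ TreeSpace) (m : Multiset X)
    (φ : X → TreeSpace) : f (m.map φ).sum = (m.map (fun x => f (φ x))).sum := by
  rw [map_multiset_sum, Multiset.map_map]; rfl

theorem sum_apply_tree {X : Type} (m : Multiset X) (φ : X → Module.End ℂ TreeSpace)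
    (v : TreeSpace) : (m.map φ).sum v = (m.map (fun x => φ x v)).sum := by
  induction m using Multiset.induction_on with
  | empty => simp
  | cons a m ih => simp [ih]

theorem op_plus_plus (t₁ t₂ : RTree) : opPlus t₁ * opPlus t₂ - opPlus t₂ * opPlus t₁ =
    ((graft t₁ t₂).map opPlus).sum - ((graft t₂ t₁).map opPlus).sum := by
  refine end_ext ?_ fun s => ?_
  · simp [sum_apply_tree, opPlus_none]
  · have h := congrArg (fun m => (m.map tree).sum) (graft_graft t₁ t₂ s)
    simp only [Multiset.map_add, Multiset.sum_add, Multiset.map_bind, Multiset.sum_bind] at h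
    simp only [LinearMap.sub_apply, Module.End.mul_apply, sum_apply_tree,
      opPlus_tree, map_multiset_sum']
    rw [sub_eq_sub_iff_add_eq_add, h, add_comm]

theorem sum_opMinus_tree (S : Finset RTree) (f : RTree → ℕ) (hf : ∀ t, f t ≠ 0 → t ∈ S)
    (s : RTree) : (∑ t ∈ S, f t • opMinus t) (tree s) =
      ((cuts s).map (fun c => f c.2 • tree c.1)).sum := by
  simp only [LinearMap.sum_apply, LinearMap.smul_apply, opMinus_tree]
  generalize cuts s = m
  induction m using Multiset.induction_on with
  | empty => simp
  | cons a m ih =>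
    simp only [Multiset.map_cons, Multiset.sum_cons, smul_add, Finset.sum_add_distrib, ih,
      smul_ite, smul_zero, Finset.sum_ite_eq, add_left_inj]
    by_cases h : f a.2 = 0
    · simp [h]
    · simp [hf _ h]

theorem numCut_smul (p q u : RTree) (v : TreeSpace) : numCut p q u • v =
    ((cuts u).map (fun e => if e.1 = p ∧ e.2 = q then v else 0)).sum := by
  rw [numCut]
  generalize cuts u = m
  induction m using Multiset.induction_on with
  | empty => simp
  | cons a m ih =>
    obtain ⟨x, y⟩ := a
    rw [Multiset.count_cons, add_smul, ih, Multiset.map_cons, Multiset.sum_cons, add_comm]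
    by_cases h : x = p ∧ y = q
    · simp [h]
    · have h' : ¬ (p, q) = (x, y) := fun e => h (by simpa [Prod.ext_iff, eq_comm] using e)
      simp [h, h']

theorem numGraft_smul (p q u : RTree) (v : TreeSpace) : numGraft p q u • v =
    ((graft q p).map (fun x => if x = u then v else 0)).sum := by
  rw [numGraft]
  generalize graft q p = m
  induction m using Multiset.induction_on with
  | empty => simp
  | cons a m ih =>
    rw [Multiset.count_cons, add_smul, ih, Multiset.map_cons, Multiset.sum_cons, add_comm]
    by_cases h : a = u
    · simp [h]
    · simp [h, Ne.symm h]

theorem op_minus_minus (t₁ t₂ : RTree) : opMinus t₁ * opMinus t₂ - opMinus t₂ * opMinus t₁ =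
    ∑ t ∈ (graft t₂ t₁).toFinset, numCut t₁ t₂ t • opMinus t -
      ∑ t ∈ (graft t₁ t₂).toFinset, numCut t₂ t₁ t • opMinus t := by
  refine end_ext ?_ fun s => ?_
  · simp [opMinus_none]
  · have hS : ∀ p q t : RTree, numCut p q t ≠ 0 → t ∈ (graft q p).toFinset := by
      intro p q t h
      rw [Multiset.mem_toFinset, ← mem_cuts_iff]
      exact Multiset.count_ne_zero.1 h
    have h := congrArg (fun m => (m.map (fun x : RTree × RTree × RTree =>
      if x.2.1 = t₁ ∧ x.2.2 = t₂ then tree x.1 else 0)).sum) (cuts_cuts s)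
    simp only [Multiset.map_add, Multiset.sum_add, Multiset.map_bind, Multiset.sum_bind,
      Multiset.map_map, Function.comp_def] at h
    have hD : ∀ p q : RTree, opMinus p (opMinus q (tree s)) = ((cuts s).map (fun c =>
        ((cuts c.1).map (fun e => if e.2 = p ∧ c.2 = q then tree e.1 else 0)).sum)).sum := by
      intro p q
      rw [opMinus_tree, map_multiset_sum']
      congr 2
      funext c
      by_cases hc : c.2 = q <;> simp [hc, opMinus_tree]
    simp only [LinearMap.sub_apply, Module.End.mul_apply]
    rw [sum_opMinus_tree _ _ (hS t₁ t₂), sum_opMinus_tree _ _ (hS t₂ t₁), hD, hD]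
    simp only [numCut_smul]
    rw [sub_eq_sub_iff_add_eq_add]
    simp only [and_comm (a := _ = t₂)]
    rw [h, add_comm]

theorem op_minus_plus (t₁ t₂ : RTree) : opMinus t₁ * opPlus t₂ - opPlus t₂ * opMinus t₁ =
    (if t₁ = t₂ then opD else 0) +
    (∑ t ∈ ((cuts t₂).map Prod.fst).toFinset, numCut t t₁ t₂ • opPlus t +
        ∑ t ∈ ((cuts t₁).map Prod.fst).toFinset, numGraft t t₂ t₁ • opMinus t) := by
  refine end_ext ?_ fun s => ?_
  · by_cases h : t₁ = t₂ <;> simp [h, opMinus_none, opPlus_none, opD_none]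
  · have hM : ∀ t, numGraft t t₂ t₁ ≠ 0 → t ∈ ((cuts t₁).map Prod.fst).toFinset := by
      intro t h
      rw [Multiset.mem_toFinset, Multiset.mem_map]
      exact ⟨(t, t₂), (mem_cuts_iff _ _ _).2 (Multiset.count_ne_zero.1 h), rfl⟩
    have hP : (∑ t ∈ ((cuts t₂).map Prod.fst).toFinset, numCut t t₁ t₂ • opPlus t) (tree s) =
        ((cuts t₂).map (fun c => if c.2 = t₁ then ((graft c.1 s).map tree).sum else 0)).sum := by
      simp only [LinearMap.sum_apply, LinearMap.smul_apply, opPlus_tree, numCut_smul]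
      have : ∀ m m' : Multiset (RTree × RTree), m' ≤ m →
          ∑ t ∈ (m.map Prod.fst).toFinset, (m'.map (fun e => if e.1 = t ∧ e.2 = t₁ then
            ((graft t s).map tree).sum else 0)).sum =
          (m'.map (fun c => if c.2 = t₁ then ((graft c.1 s).map tree).sum else 0)).sum := by
        intro m m' hm
        induction m' using Multiset.induction_on with
        | empty => simp
        | cons a m' ih =>
          have ha : a.1 ∈ (m.map Prod.fst).toFinset := by
            rw [Multiset.mem_toFinset]
            exact Multiset.mem_map_of_mem _ (Multiset.mem_of_le hm (Multiset.mem_cons_self _ _))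
          simp only [Multiset.map_cons, Multiset.sum_cons, Finset.sum_add_distrib,
            ih ((Multiset.le_cons_self _ _).trans hm), add_left_inj]
          by_cases h : a.2 = t₁
          · simp only [h, and_true, if_true, Finset.sum_ite_eq, if_pos ha]
          · simp [h]
      exact this _ _ le_rfl
    have h := congrArg (fun m => (m.map (fun x : RTree × RTree =>
      if x.2 = t₁ then tree x.1 else 0)).sum) (graft_cuts t₂ s)
    simp only [Multiset.map_add, Multiset.sum_add, Multiset.map_bind, Multiset.sum_bind,
      Multiset.map_map, Function.comp_def, Multiset.map_replicate, Multiset.sum_replicate] at h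
    have h1 : ((cuts t₂).map (fun c => ((graft c.1 s).map
        (fun x => if c.2 = t₁ then tree x else 0)).sum)).sum =
        ((cuts t₂).map (fun c => if c.2 = t₁ then ((graft c.1 s).map tree).sum else 0)).sum := by
      congr 2
      funext c
      by_cases hc : c.2 = t₁ <;> simp [hc]
    have h2 : ((cuts s).map (fun c => ((graft t₂ c.1).map
        (fun x => if c.2 = t₁ then tree x else 0)).sum)).sum =
        opPlus t₂ (opMinus t₁ (tree s)) := by
      rw [opMinus_tree, map_multiset_sum']
      congr 2
      funext c
      by_cases hc : c.2 = t₁ <;> simp [hc, opPlus_tree]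
    have h3 : (size s • if t₂ = t₁ then tree s else 0) =
        (if t₁ = t₂ then opD else 0 : Module.End ℂ TreeSpace) (tree s) := by
      by_cases hc : t₁ = t₂
      · simp [hc, opD_tree, Nat.cast_smul_eq_nsmul]
      · simp [hc, Ne.symm hc]
    rw [h1, h2, h3] at h
    simp only [LinearMap.sub_apply, Module.End.mul_apply, LinearMap.add_apply]
    rw [sum_opMinus_tree _ _ hM, hP, opPlus_tree, map_multiset_sum']
    simp only [numGraft_smul, opMinus_tree]
    rw [h, ← opMinus_tree]
    abel

theorem op_d_plus (t : RTree) : opD * opPlus t - opPlus t * opD = (size t : ℂ) • opPlus t := by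
  refine end_ext ?_ fun s => ?_
  · simp [opD_none, opPlus_none]
  · simp only [LinearMap.sub_apply, Module.End.mul_apply, LinearMap.smul_apply, opD_tree, map_smul]
    rw [sub_eq_iff_eq_add, ← add_smul, opPlus_tree, map_multiset_sum', Multiset.smul_sum,
      Multiset.map_map]
    congr 1
    refine Multiset.map_congr rfl fun u hu => ?_
    rw [opD_tree, size_of_mem_graft hu, Function.comp_apply]
    push_cast
    rw [add_comm]

theorem op_d_minus (t : RTree) :
    opD * opMinus t - opMinus t * opD = -((size t : ℂ) • opMinus t) := by
  refine end_ext ?_ fun s => ?_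
  · simp [opD_none, opMinus_none]
  · simp only [LinearMap.sub_apply, Module.End.mul_apply, LinearMap.neg_apply, LinearMap.smul_apply,
      opD_tree, map_smul]
    rw [sub_eq_iff_eq_add, ← neg_smul, ← add_smul, opMinus_tree, map_multiset_sum',
      Multiset.smul_sum, Multiset.map_map]
    congr 1
    refine Multiset.map_congr rfl fun c hc => ?_
    have hs : size s = size c.1 + size c.2 := size_of_mem_graft ((mem_cuts_iff _ _ _).1 hc)
    by_cases h : c.2 = t
    · rw [h] at hs
      simp [h, hs, opD_tree]
    · simp [h]

attribute [local instance 100] LieRing.ofAssociativeRing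

/-- The operators of the generators on `𝒯`. -/
noncomputable def genOp : Gen → Module.End ℂ TreeSpace
  | .plus t => opPlus t
  | .minus t => opMinus t
  | .d => opD

/-- The action of the free Lie algebra on `𝒯`. -/
noncomputable def freeAction : FreeLieAlgebra ℂ Gen →ₗ⁅ℂ⁆ Module.End ℂ TreeSpace :=
  FreeLieAlgebra.lift ℂ genOp

theorem freeAction_relation {x y : FreeLieAlgebra ℂ Gen} (h : Relation x y) :
    freeAction x = freeAction y := by
  have hms : ∀ m : Multiset RTree, ∀ f : RTree → FreeLieAlgebra ℂ Gen,
      freeAction (m.map f).sum = (m.map (fun t => freeAction (f t))).sum := by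
    intro m f
    induction m using Multiset.induction_on with
    | empty => simp
    | cons a m ih => simp [ih]
  have hfs : ∀ S : Finset RTree, ∀ f : RTree → FreeLieAlgebra ℂ Gen,
      freeAction (∑ t ∈ S, f t) = ∑ t ∈ S, freeAction (f t) := fun S f => hms S.1 f
  have hn : ∀ (n : ℕ) (z : FreeLieAlgebra ℂ Gen), freeAction (n • z) = n • freeAction z :=
    fun n z => map_nsmul freeAction n z
  have hp : ∀ t, freeAction (FreeLieAlgebra.of ℂ (Gen.plus t)) = opPlus t :=
    fun t => FreeLieAlgebra.lift_of_apply _ _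
  have hm : ∀ t, freeAction (FreeLieAlgebra.of ℂ (Gen.minus t)) = opMinus t :=
    fun t => FreeLieAlgebra.lift_of_apply _ _
  have hd : freeAction (FreeLieAlgebra.of ℂ Gen.d) = opD := FreeLieAlgebra.lift_of_apply _ _
  cases h with
  | plus_plus t₁ t₂ =>
    rw [LieHom.map_lie, map_sub, hms, hms]
    simp only [hp]
    exact op_plus_plus t₁ t₂
  | minus_minus t₁ t₂ =>
    rw [LieHom.map_lie, map_sub, hfs, hfs]
    simp only [hm, hn]
    exact op_minus_minus t₁ t₂
  | minus_plus t₁ t₂ h =>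
    rw [LieHom.map_lie, map_add, hfs, hfs]
    simp only [hm, hn, hp]
    refine (op_minus_plus t₁ t₂).trans ?_
    rw [if_neg h, zero_add]
  | minus_plus_self t =>
    rw [LieHom.map_lie, hm, hp, hd]
    refine (op_minus_plus t t).trans ?_
    have h1 : ∀ p q : RTree, numCut p q q = 0 := by
      intro p q
      refine Multiset.count_eq_zero.2 fun h => ?_
      have := size_of_mem_graft ((mem_cuts_iff _ _ _).1 h)
      have := size_pos p
      omega
    have h2 : ∀ p q : RTree, numGraft p q q = 0 := by
      intro p q
      refine Multiset.count_eq_zero.2 fun h => ?_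
      have := size_of_mem_graft h
      have := size_pos p
      omega
    simp [h1, h2]
  | d_minus t =>
    rw [LieHom.map_lie, map_neg, map_smul, hm, hd]
    exact op_d_minus t
  | d_plus t =>
    rw [LieHom.map_lie, map_smul, hp, hd]
    exact op_d_plus t

theorem relationIdeal_le : relationIdeal ≤ freeAction.ker := by
  rw [relationIdeal, LieSubmodule.lieSpan_le]
  rintro z ⟨x, y, h, rfl⟩
  rw [SetLike.mem_coe, LieHom.mem_ker, map_sub, freeAction_relation h, sub_self]

/-- The representation of `𝔤` on `𝒯`. -/
noncomputable def action : InsElim →ₗ⁅ℂ⁆ Module.End ℂ TreeSpace :=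
  { relationIdeal.toSubmodule.liftQ
      (freeAction : FreeLieAlgebra ℂ Gen →ₗ[ℂ] Module.End ℂ TreeSpace)
      (fun z hz => LieHom.mem_ker.1 (relationIdeal_le hz)) with
    map_lie' := by
      intro x y
      induction x using Submodule.Quotient.induction_on
      induction y using Submodule.Quotient.induction_on
      exact LieHom.map_lie freeAction _ _ }

noncomputable instance : LieRingModule InsElim TreeSpace :=
  LieRingModule.compLieHom TreeSpace action

instance : LieModule ℂ InsElim TreeSpace := LieModule.compLieHom TreeSpace action

theorem Dplus_lie (t : RTree) (v : TreeSpace) : ⁅Dplus t, v⁆ = opPlus t v :=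
  congrArg (fun f : Module.End ℂ TreeSpace => f v)
    (FreeLieAlgebra.lift_of_apply genOp (Gen.plus t))

theorem Dminus_lie (t : RTree) (v : TreeSpace) : ⁅Dminus t, v⁆ = opMinus t v :=
  congrArg (fun f : Module.End ℂ TreeSpace => f v)
    (FreeLieAlgebra.lift_of_apply genOp (Gen.minus t))

theorem dElt_lie (v : TreeSpace) : ⁅dElt, v⁆ = opD v :=
  congrArg (fun f : Module.End ℂ TreeSpace => f v)
    (FreeLieAlgebra.lift_of_apply genOp Gen.d)

theorem lie_emptyTree (x : InsElim) : ⁅x, emptyTree⁆ = 0 := by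
  let K : LieSubalgebra ℂ (Module.End ℂ TreeSpace) :=
    { carrier := {f | f emptyTree = 0}
      add_mem' := by intro f g hf hg; simp_all
      zero_mem' := by simp
      smul_mem' := by intro c f hf; simp_all
      lie_mem' := by
        intro f g hf hg
        change f (g emptyTree) - g (f emptyTree) = 0
        have hf' : f emptyTree = 0 := hf
        have hg' : g emptyTree = 0 := hg
        rw [hf', hg', map_zero, map_zero, sub_zero] }
  have hK : ∀ g : Gen, genOp g ∈ K := by
    rintro (t | t | _)
    · exact opPlus_none t
    · exact opMinus_none t
    · exact opD_none
  let F : FreeLieAlgebra ℂ Gen →ₗ⁅ℂ⁆ K := FreeLieAlgebra.lift ℂ fun g => ⟨genOp g, hK g⟩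
  have hF : K.incl.comp F = freeAction := by
    refine FreeLieAlgebra.hom_ext fun g => ?_
    rw [LieHom.comp_apply, FreeLieAlgebra.lift_of_apply, freeAction, FreeLieAlgebra.lift_of_apply]
    rfl
  induction x using Submodule.Quotient.induction_on with
  | H z =>
    change freeAction z emptyTree = 0
    rw [← hF]
    exact (F z).2

/-- The subrepresentation `ℂ · 1` of `𝒯`. -/
noncomputable def emptyLine : LieSubmodule ℂ InsElim TreeSpace :=
  { Submodule.span ℂ {emptyTree} with
    lie_mem := by
      intro x m hm
      obtain ⟨c, rfl⟩ := Submodule.mem_span_singleton.1 hm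
      rw [lie_smul, lie_emptyTree, smul_zero]
      exact Submodule.zero_mem _ }

/-- The representation `M = 𝒯 / ℂ · 1`. -/
abbrev TreeQuot : Type := TreeSpace ⧸ emptyLine

/-- The class in `M` of a rooted tree. -/
noncomputable def treeClass (t : RTree) : TreeQuot := LieSubmodule.Quotient.mk (tree t)

/-! ### Weights and Verma modules -/

section Weights

variable (V : Type) [AddCommGroup V] [Module ℂ V] [LieRingModule InsElim V] [LieModule ℂ InsElim V]

/-- The eigenspace `V_δ` of `d` on a representation `V`. -/
noncomputable def weightSpace (δ : ℂ) : Submodule ℂ V :=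
  Module.End.eigenspace (LieModule.toEnd ℂ InsElim V dElt) δ

variable {V}

/-- `w` is a lowest-weight vector of weight `δ`: a non-zero vector of `V_δ` with `𝔫₋ w = 0`. -/
def IsLowestWeightVector (δ : ℂ) (w : V) : Prop :=
  w ≠ 0 ∧ w ∈ weightSpace V δ ∧ ∀ x ∈ nMinus, ⁅x, w⁆ = 0

end Weights

/-- The left ideal of `U(𝔤)` generated by `𝔫₋` and `d - δ`. -/
noncomputable def vermaIdeal (δ : ℂ) : Ideal (UniversalEnvelopingAlgebra ℂ InsElim) :=
  Ideal.span ({u | ∃ x ∈ nMinus, u = UniversalEnvelopingAlgebra.ι ℂ x} ∪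
    {UniversalEnvelopingAlgebra.ι ℂ dElt - algebraMap ℂ _ δ})

/-- The Verma module `W(δ)`, the representation of `𝔤` induced from the one-dimensional
representation of `ℂ d ⊕ 𝔫₋` on which `𝔫₋` acts by zero and `d` by `δ`, as the quotient of `U(𝔤)` by
the left ideal generated by `𝔫₋` and `d - δ`. -/
abbrev Verma (δ : ℂ) : Type := UniversalEnvelopingAlgebra ℂ InsElim ⧸ vermaIdeal δ

noncomputable instance (δ : ℂ) : LieRingModule InsElim (Verma δ) where
  bracket x w := UniversalEnvelopingAlgebra.ι ℂ x • w
  add_lie x y w := by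
    change UniversalEnvelopingAlgebra.ι ℂ (x + y) • w = _
    rw [map_add, add_smul]
  lie_add x v w := smul_add _ v w
  leibniz_lie x y w := by
    change _ • _ • w = UniversalEnvelopingAlgebra.ι ℂ ⁅x, y⁆ • w + _ • _ • w
    rw [LieHom.map_lie, LieRing.of_associative_ring_bracket, sub_smul, mul_smul, mul_smul,
      sub_add_cancel]

instance (δ : ℂ) : LieModule ℂ InsElim (Verma δ) where
  smul_lie c x w := by
    change UniversalEnvelopingAlgebra.ι ℂ (c • x) • w = c • UniversalEnvelopingAlgebra.ι ℂ x • w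
    rw [map_smul, smul_assoc]
  lie_smul c x w := by
    change UniversalEnvelopingAlgebra.ι ℂ x • c • w = c • UniversalEnvelopingAlgebra.ι ℂ x • w
    rw [smul_comm]

/-- The lowest-weight vector of `W(δ)`, the class of `1`. -/
noncomputable def vermaVector (δ : ℂ) : Verma δ := Submodule.Quotient.mk 1

/-! ### Forests -/

/-- Forests of rooted trees. -/
abbrev Forest : Type := Multiset RTree

/-- The number of vertices of a forest. -/
def forestSize (F : Forest) : ℕ := (F.map size).sum

/-- The rooted tree obtained from a forest by adding a root, joined to the roots of its trees. -/
def addRoot (F : Forest) : RTree := F.foldr join vertex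

/-- `D⁺_{t_k} ⋯ D⁺_{t_1} w` for the list `t_1, …, t_k`. -/
noncomputable def applyPlus {V : Type} [AddCommGroup V] [LieRingModule InsElim V] (l : List RTree)
    (w : V) : V :=
  l.foldl (fun v t => ⁅Dplus t, v⁆) w

/-- The vector `D⁺_F v = D⁺_{t_k} ⋯ D⁺_{t_1} v` of `W(δ)`, where `v` is the lowest-weight vector and
`t_1 ≤ ⋯ ≤ t_k` are the trees of the forest `F` in the order `r`. -/
noncomputable def forestVector (r : RTree → RTree → Prop) [DecidableRel r] [IsTrans RTree r]
    [Std.Antisymm r] [Std.Total r] (δ : ℂ) (F : Forest) : Verma δ :=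
  applyPlus (F.sort r) (vermaVector δ)

end InsertionElimination

/-! Everything rests on the number of branches at the root. Among the graftings of `t` on `s`, the
one at the root gives `join t s`, with one branch more than `s`; all others keep the number of
branches (`graft_eq_cons`). So `D⁺_t s` is `join t s` plus trees with as many branches at the root
as `s`. By induction `D⁺_{t_k} ⋯ D⁺_{t_1} •` is `B(t_1, …, t_k)` plus trees with fewer branches
(`applyPlus_vertex_sub_addRoot_mem`). As the trees `B(F)` form a basis of `M`, this is a
unitriangular system.

On the side of `W(1)`, the words in the `D⁺_t` applied to `v` span, because `[D⁻, D⁺]` is a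
combination of generators and `v` is an eigenvector of `d` killed by `𝔫₋`. Since `[D⁺, D⁺]` is a
combination of `D⁺`'s, reordering a word costs only shorter words, and one word per forest is enough
(`forestVector_span_eq_top`). Linear independence needs no Poincaré–Birkhoff–Witt theorem. The
homomorphism `W(1) → M`, composed with the surjection `M → W(1)`, `B(F) ↦ D⁺_F v`, is unitriangular,
hence bijective (`comp_treeToVerma_bijective`), so both maps are bijective.

The dual triangularity finds the lowest-weight vectors. The coefficient of `s` in `D⁻_t x` involves
the coefficient of `x` at `join t s` and otherwise only at trees with as many branches as `s`.
Induction on the number of branches shows that a vector killed by all `D⁻_t` is a multiple of `•`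
(`mem_span_vertex_of_Dminus_lie_eq_zero`). The `D⁻_t` lower the number of vertices, so every
non-zero subrepresentation of `M` contains `•`. Since `•` generates `M`, `M` is irreducible, and so
is `W(1)`. -/

namespace InsertionElimination

open Module

/-! ### Branches at the root -/

namespace RTree

/-- The branches of a rooted tree at its root. -/
def branches : RTree → Multiset RTree :=
  recur 0 (fun a _ _ B => a ::ₘ B) (fun a b _ _ _ z => Multiset.cons_swap a b z)

theorem branches_join (a t : RTree) : branches (join a t) = a ::ₘ branches t := by
  induction a using Quotient.inductionOn
  induction t using Quotient.inductionOn
  rfl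

/-- The number of branches at the root. -/
def rootDegree (t : RTree) : ℕ := (branches t).card

theorem rootDegree_join (a t : RTree) : rootDegree (join a t) = rootDegree t + 1 := by
  rw [rootDegree, branches_join, Multiset.card_cons, rootDegree]

theorem addRoot_cons (a : RTree) (F : Forest) : addRoot (a ::ₘ F) = join a (addRoot F) :=
  Multiset.foldr_cons _ _ _ _

theorem addRoot_branches (t : RTree) : addRoot (branches t) = t := by
  induction t using ind with
  | h1 => rfl
  | h2 a t _ ih => rw [branches_join, addRoot_cons, ih]

theorem branches_addRoot (F : Forest) : branches (addRoot F) = F := by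
  induction F using Multiset.induction_on with
  | empty => rfl
  | cons a F ih => rw [addRoot_cons, branches_join, ih]

/-- Adding a root is a bijection from forests to rooted trees. -/
def addRootEquiv : Forest ≃ RTree := ⟨addRoot, branches, branches_addRoot, addRoot_branches⟩

theorem size_addRoot (F : Forest) : size (addRoot F) = forestSize F + 1 := by
  induction F using Multiset.induction_on with
  | empty => rfl
  | cons a F ih =>
    rw [addRoot_cons, size_join, ih, forestSize, forestSize, Multiset.map_cons, Multiset.sum_cons,
      add_assoc]

/-- Exactly one way of grafting creates a new branch at the root. -/
theorem graft_eq_cons (q p : RTree) :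
    ∃ m, graft q p = join q p ::ₘ m ∧ ∀ u ∈ m, rootDegree u = rootDegree p := by
  induction p using ind with
  | h1 => exact ⟨0, rfl, by simp⟩
  | h2 a t _ ih =>
    obtain ⟨m, hm, h⟩ := ih
    refine ⟨(graft q a).map (fun x => join x t) + m.map (fun y => join a y), ?_, ?_⟩
    · rw [graft_join, hm, Multiset.map_cons, Multiset.add_cons, join_left_comm]
    · intro u hu
      rw [Multiset.mem_add, Multiset.mem_map, Multiset.mem_map] at hu
      obtain ⟨x, _, rfl⟩ | ⟨x, hx, rfl⟩ := hu
      · rw [rootDegree_join, rootDegree_join]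
      · rw [rootDegree_join, rootDegree_join, h x hx]

theorem join_mem_graft (q p : RTree) : join q p ∈ graft q p := by
  obtain ⟨m, hm, _⟩ := graft_eq_cons q p
  rw [hm]
  exact Multiset.mem_cons_self _ _

theorem eq_join_or_rootDegree_eq {u q p : RTree} (h : u ∈ graft q p) :
    u = join q p ∨ rootDegree u = rootDegree p := by
  obtain ⟨m, hm, h'⟩ := graft_eq_cons q p
  rw [hm, Multiset.mem_cons] at h
  exact h.imp_right (h' u)

end RTree

open RTree

/-! ### The filtration of a vector space by a degree on a basis -/

section Filtration

variable {ι V : Type} [AddCommGroup V] [Module ℂ V]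

/-- The span of the basis vectors of degree less than `n`. -/
def degreeLT (b : Basis ι ℂ V) (f : ι → ℕ) (n : ℕ) : Submodule ℂ V :=
  Submodule.span ℂ (b '' {i | f i < n})

theorem degreeLT_zero (b : Basis ι ℂ V) (f : ι → ℕ) : degreeLT b f 0 = ⊥ := by
  simp [degreeLT]

theorem degreeLT_mono (b : Basis ι ℂ V) (f : ι → ℕ) {m n : ℕ} (h : m ≤ n) :
    degreeLT b f m ≤ degreeLT b f n :=
  Submodule.span_mono (Set.image_mono fun _ hi => lt_of_lt_of_le hi h)

theorem basis_mem_degreeLT (b : Basis ι ℂ V) (f : ι → ℕ) {i : ι} {n : ℕ} (h : f i < n) :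
    b i ∈ degreeLT b f n :=
  Submodule.subset_span ⟨i, h, rfl⟩

theorem exists_mem_degreeLT (b : Basis ι ℂ V) (f : ι → ℕ) (x : V) :
    ∃ n, x ∈ degreeLT b f n := by
  refine ⟨(b.repr x).support.sup f + 1, b.mem_span_image.2 fun i hi => ?_⟩
  exact Nat.lt_succ_of_le (Finset.le_sup (f := f) hi)

/-- All bounds are strict, so `l = 0` says that `T` lowers the degree by at least one, and `l = 2`
that it raises it by at most one. -/
theorem map_mem_degreeLT (b : Basis ι ℂ V) (f : ι → ℕ) {k l : ℕ} (T : V →ₗ[ℂ] V)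
    (hT : ∀ i, T (b i) ∈ degreeLT b f (f i + l)) {x : V} (hx : x ∈ degreeLT b f (k + 1)) :
    T x ∈ degreeLT b f (k + l) := by
  have : degreeLT b f (k + 1) ≤ (degreeLT b f (k + l)).comap T := by
    refine Submodule.span_le.2 ?_
    rintro _ ⟨i, hi, rfl⟩
    have hi' : f i < k + 1 := hi
    exact degreeLT_mono b f (by omega) (hT i)
  exact this hx

/-- A map is bijective if it is the identity up to vectors of smaller degree. -/
theorem bijective_of_unitriangular (b : Basis ι ℂ V) (f : ι → ℕ) (T : V →ₗ[ℂ] V)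
    (hT : ∀ i, T (b i) - b i ∈ degreeLT b f (f i)) : Function.Bijective T := by
  -- `T - 1` lowers degrees. Hence a vector of the kernel, which is minus its own error `T x - x`,
  -- can be pushed down to degree `< 0`. For surjectivity, `x` is corrected by a preimage of that
  -- error.
  have h : ∀ k x, x ∈ degreeLT b f (k + 1) → T x - x ∈ degreeLT b f k := fun k x hx =>
    map_mem_degreeLT b f (k := k) (l := 0) (T - LinearMap.id) hT hx
  constructor
  · refine (injective_iff_map_eq_zero T).2 fun x hx => ?_
    obtain ⟨n, hn⟩ := exists_mem_degreeLT b f x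
    induction n with
    | zero => rwa [degreeLT_zero, Submodule.mem_bot] at hn
    | succ n ih =>
      have := h n x hn
      rw [hx, zero_sub, neg_mem_iff] at this
      exact ih this
  · intro x
    obtain ⟨n, hn⟩ := exists_mem_degreeLT b f x
    induction n generalizing x with
    | zero =>
      rw [degreeLT_zero, Submodule.mem_bot] at hn
      exact ⟨0, by rw [hn, map_zero]⟩
    | succ n ih =>
      obtain ⟨y, hy⟩ := ih _ (h n x hn)
      exact ⟨x - y, by rw [map_sub, hy, sub_sub_cancel]⟩

end Filtration

/-! ### Irreducibility and weight spaces: diagonal bases and transport along isomorphisms -/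

section Irreducible

variable {V : Type} [AddCommGroup V] [Module ℂ V] [LieRingModule InsElim V]

theorem lieSubmodule_ne_bot_iff {N : LieSubmodule ℂ InsElim V} :
    N ≠ ⊥ ↔ ∃ x ∈ N, x ≠ 0 := by
  rw [Ne, LieSubmodule.eq_bot_iff]
  push Not
  rfl

theorem isIrreducible_of_bijective {W : Type} [AddCommGroup W] [Module ℂ W]
    [LieRingModule InsElim W] [LieModule ℂ InsElim W] (φ : V →ₗ⁅ℂ,InsElim⁆ W)
    (hφ : Function.Bijective φ) [LieModule.IsIrreducible ℂ InsElim W] :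
    LieModule.IsIrreducible ℂ InsElim V := by
  have : Nontrivial W := LieModule.nontrivial_of_isIrreducible ℂ InsElim W
  have : Nontrivial V := hφ.2.nontrivial
  refine LieModule.IsIrreducible.mk fun N hN => ?_
  obtain ⟨x, hx, hx0⟩ := lieSubmodule_ne_bot_iff.1 hN
  have h : N.map φ = ⊤ := (eq_bot_or_eq_top _).resolve_left <|
    lieSubmodule_ne_bot_iff.2 ⟨φ x, (LieSubmodule.mem_map _).2 ⟨x, hx, rfl⟩,
      fun h => hx0 (hφ.1 (h.trans (map_zero φ).symm))⟩
  refine eq_top_iff.2 fun y _ => ?_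
  obtain ⟨z, hz, hzy⟩ := (LieSubmodule.mem_map _).1 (h ▸ LieSubmodule.mem_top (φ y) :
    φ y ∈ N.map φ)
  exact hφ.1 hzy ▸ hz

end Irreducible

section Weights

variable {V : Type} [AddCommGroup V] [Module ℂ V] [LieRingModule InsElim V] [LieModule ℂ InsElim V]

theorem mem_weightSpace {δ : ℂ} {x : V} : x ∈ weightSpace V δ ↔ ⁅dElt, x⁆ = δ • x :=
  Module.End.mem_eigenspace_iff

/-- As `d` is diagonal in the basis, an eigenvector of eigenvalue `n` satisfies `w i * x_i = n *
x_i` in each coordinate, so only the coordinates with `w i = n` survive. -/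
theorem weightSpace_eq_span {ι : Type} (b : Basis ι ℂ V) (w : ι → ℕ)
    (hw : ∀ i, ⁅dElt, b i⁆ = (w i : ℂ) • b i) (n : ℕ) :
    weightSpace V n = Submodule.span ℂ (b '' {i | w i = n}) := by
  refine le_antisymm (fun x hx => ?_) (Submodule.span_le.2 ?_)
  · have h : ∀ i, b.repr ⁅dElt, x⁆ i = w i * b.repr x i := by
      intro i
      have : (b.coord i ∘ₗ LieModule.toEnd ℂ InsElim V dElt) = (w i : ℂ) • b.coord i := by
        refine b.ext fun j => ?_
        by_cases hij : j = i
        · subst hij; simp [hw]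
        · simp [hw, hij]
      exact congrArg (fun f : V →ₗ[ℂ] ℂ => f x) this
    rw [b.mem_span_image]
    intro i hi
    have h1 := h i
    rw [mem_weightSpace.1 hx, map_smul, Finsupp.smul_apply, smul_eq_mul] at h1
    have := mul_right_cancel₀ (Finsupp.mem_support_iff.1 hi) h1
    exact_mod_cast this.symm
  · rintro _ ⟨i, hi, rfl⟩
    have hi' : w i = n := hi
    exact mem_weightSpace.2 (by rw [hw, hi'])

theorem map_weightSpace {W : Type} [AddCommGroup W] [Module ℂ W] [LieRingModule InsElim W]
    [LieModule ℂ InsElim W] (φ : V →ₗ⁅ℂ,InsElim⁆ W) (hφ : Function.Bijective φ) (δ : ℂ) :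
    (weightSpace V δ).map (φ : V →ₗ[ℂ] W) = weightSpace W δ := by
  ext y
  constructor
  · rintro ⟨x, hx, rfl⟩
    have := congrArg φ (mem_weightSpace.1 hx)
    rw [LieModuleHom.map_lie, map_smul] at this
    exact mem_weightSpace.2 this
  · intro hy
    obtain ⟨x, rfl⟩ := hφ.2 y
    refine ⟨x, mem_weightSpace.2 (hφ.1 ?_), rfl⟩
    rw [LieModuleHom.map_lie, map_smul]
    exact mem_weightSpace.1 hy

end Weights

/-! ### The representation `M` -/

/-- The coordinates of an element of `M`. -/
noncomputable def treeCoord : TreeQuot →ₗ[ℂ] RTree →₀ ℂ :=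
  emptyLine.toSubmodule.liftQ
    (Finsupp.linearCombination ℂ fun o : Option RTree => match o with
      | none => (0 : RTree →₀ ℂ)
      | some s => Finsupp.single s 1)
    (by
      refine (Submodule.span_singleton_le_iff_mem _ _).2 ?_
      simp [emptyTree])

theorem treeCoord_treeClass (t : RTree) : treeCoord (treeClass t) = Finsupp.single t 1 := by
  refine (Submodule.liftQ_apply _ _ _).trans ?_
  simp [tree]

/-- The basis of `M` consisting of the trees. -/
noncomputable def treeBasis : Basis RTree ℂ TreeQuot :=
  .ofRepr <| LinearEquiv.ofLinearMap treeCoord (Finsupp.linearCombination ℂ treeClass)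
    (Finsupp.lhom_ext' fun t => LinearMap.ext_ring (by simp [treeCoord_treeClass]))
    (by
      refine Submodule.linearMap_qext _ (Finsupp.lhom_ext' fun o => LinearMap.ext_ring ?_)
      cases o with
      | none =>
        have h : (LieSubmodule.Quotient.mk emptyTree : TreeQuot) = 0 :=
          LieSubmodule.Quotient.mk_eq_zero'.2 (Submodule.mem_span_singleton_self _)
        change Finsupp.linearCombination ℂ treeClass
          (treeCoord (LieSubmodule.Quotient.mk emptyTree)) = LieSubmodule.Quotient.mk emptyTree
        rw [h, map_zero, map_zero]
      | some s =>
        change Finsupp.linearCombination ℂ treeClass (treeCoord (treeClass s)) = treeClass s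
        rw [treeCoord_treeClass, Finsupp.linearCombination_single, one_smul])

theorem treeBasis_apply (t : RTree) : treeBasis t = treeClass t := by
  rw [Basis.apply_eq_iff]
  exact treeCoord_treeClass t

theorem mk_multiset_sum {X : Type} (m : Multiset X) (f : X → TreeSpace) :
    (LieSubmodule.Quotient.mk (m.map f).sum : TreeQuot) =
      (m.map fun x => (LieSubmodule.Quotient.mk (f x) : TreeQuot)).sum := by
  have := map_multiset_sum (LieSubmodule.Quotient.mk' emptyLine) (m.map f)
  rw [Multiset.map_map] at this
  exact this

theorem Dplus_lie_treeClass (t s : RTree) :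
    ⁅Dplus t, treeClass s⁆ = ((graft t s).map treeClass).sum := by
  have h := (LieSubmodule.Quotient.mk' emptyLine).map_lie (Dplus t) (tree s)
  rw [Dplus_lie, opPlus_tree] at h
  exact h.symm.trans (mk_multiset_sum _ _)

theorem Dminus_lie_treeClass (t s : RTree) :
    ⁅Dminus t, treeClass s⁆ =
      ((cuts s).map fun c => if c.2 = t then treeClass c.1 else 0).sum := by
  have h := (LieSubmodule.Quotient.mk' emptyLine).map_lie (Dminus t) (tree s)
  rw [Dminus_lie, opMinus_tree] at h
  refine h.symm.trans ((mk_multiset_sum _ _).trans ?_)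
  congr 2
  funext c
  split_ifs <;> rfl

theorem dElt_lie_treeClass (s : RTree) : ⁅dElt, treeClass s⁆ = (size s : ℂ) • treeClass s := by
  have h := (LieSubmodule.Quotient.mk' emptyLine).map_lie dElt (tree s)
  rw [dElt_lie, opD_tree] at h
  exact h.symm

/-- Both sides are linear in `x`, so it is enough to count the cuts of a single tree. This is row
`s` of the matrix of `D⁻_t`, the form needed to solve `D⁻_t x = 0` coefficient by coefficient. -/
theorem repr_Dminus_lie (t s : RTree) (x : TreeQuot) : treeBasis.repr ⁅Dminus t, x⁆ s =
    (treeBasis.repr x).sum fun u c => c * numCut s t u := by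
  have : treeBasis.coord s ∘ₗ LieModule.toEnd ℂ InsElim TreeQuot (Dminus t) =
      Finsupp.linearCombination ℂ (fun u => (numCut s t u : ℂ)) ∘ₗ
        (treeBasis.repr : TreeQuot →ₗ[ℂ] RTree →₀ ℂ) := by
    refine treeBasis.ext fun u => ?_
    simp only [LinearMap.comp_apply, LieModule.toEnd_apply_apply, LinearEquiv.coe_coe,
      Basis.repr_self, Finsupp.linearCombination_single, one_smul]
    rw [treeBasis_apply, Dminus_lie_treeClass, numCut]
    generalize cuts u = m
    induction m using Multiset.induction_on with
    | empty => simp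
    | cons a m ih =>
      obtain ⟨p, q⟩ := a
      rw [Multiset.map_cons, Multiset.sum_cons, map_add, ih, Multiset.count_cons, Nat.cast_add,
        add_comm]
      congr 1
      by_cases hq : q = t
      · by_cases hp : p = s
        · simp [hq, hp, ← treeBasis_apply]
        · simp [hq, ← treeBasis_apply, Ne.symm hp]
      · simp [hq, Ne.symm hq]
  exact congrArg (fun f : TreeQuot →ₗ[ℂ] ℂ => f x) this

/-- A vector of `M` killed by every `D⁻_t` is a multiple of `•`. -/
theorem mem_span_vertex_of_Dminus_lie_eq_zero {x : TreeQuot} (h : ∀ t, ⁅Dminus t, x⁆ = 0) :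
    x ∈ Submodule.span ℂ {treeClass RTree.vertex} := by
  -- Induction on the number of branches at the root. For `u = join t s` the coefficient of `s` in
  -- `D⁻_t x = 0` is read off: any other tree `v` that contributes has as many branches as `s`, one
  -- fewer than `u`, so its coefficient in `x` is already known to vanish.
  have key : ∀ n u, rootDegree u = n → u ≠ RTree.vertex → treeBasis.repr x u = 0 := by
    intro n
    induction n using Nat.strong_induction_on with
    | _ n ih =>
      intro u hu hv
      induction u using RTree.ind with
      | h1 => exact absurd rfl hv
      | h2 t s _ _ =>
        have h1 := repr_Dminus_lie t s x
        rw [h, map_zero, Finsupp.zero_apply, Finsupp.sum,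
          Finset.sum_eq_single (join t s)] at h1
        · refine (mul_eq_zero.1 h1.symm).resolve_right (Nat.cast_ne_zero.2 ?_)
          exact Multiset.count_ne_zero.2 ((mem_cuts_iff _ _ _).2 (join_mem_graft t s))
        · intro v _ hvne
          by_cases hc : numCut s t v = 0
          · rw [hc, Nat.cast_zero, mul_zero]
          · have hmem := (mem_cuts_iff _ _ _).1 (Multiset.count_ne_zero.1 hc)
            rw [rootDegree_join] at hu
            rw [ih (rootDegree s) (by omega) v
              ((eq_join_or_rootDegree_eq hmem).resolve_left hvne), zero_mul]
            -- The induction hypothesis excludes `•`; here `v` has at least two vertices, being a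
            -- grafting of `t` on `s`.
            rintro rfl
            have h2 := size_of_mem_graft hmem
            have := size_pos s
            have := size_pos t
            rw [size_vertex] at h2
            omega
        · intro hn
          rw [Finsupp.notMem_support_iff.1 hn, zero_mul]
  rw [← treeBasis_apply, ← Set.image_singleton, treeBasis.mem_span_image]
  intro u hu
  by_contra hv
  exact Finsupp.mem_support_iff.1 hu (key _ u rfl hv)

theorem Dminus_lie_vertex (t : RTree) : ⁅Dminus t, treeClass RTree.vertex⁆ = 0 := by
  rw [Dminus_lie_treeClass, cuts_vertex, Multiset.map_zero, Multiset.sum_zero]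

section nMinus

variable {V : Type} [AddCommGroup V] [Module ℂ V] [LieRingModule InsElim V] [LieModule ℂ InsElim V]

/-- The annihilator of a vector is a Lie subalgebra, so it is enough to test the generators of `𝔫₋`.
-/
theorem nMinus_lie_eq_zero {w : V} (h : ∀ t, ⁅Dminus t, w⁆ = 0) {x : InsElim} (hx : x ∈ nMinus) :
    ⁅x, w⁆ = 0 := by
  induction hx using LieSubalgebra.lieSpan_induction with
  | mem x hx =>
    obtain ⟨t, rfl⟩ := hx
    exact h t
  | zero => exact zero_lie w
  | add x y _ _ hx hy => rw [add_lie, hx, hy, add_zero]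
  | smul c x _ hx => rw [smul_lie, hx, smul_zero]
  | lie x y _ _ hx hy => rw [lie_lie, hx, hy, lie_zero, lie_zero, sub_zero]

theorem Dminus_mem_nMinus (t : RTree) : Dminus t ∈ nMinus :=
  LieSubalgebra.subset_lieSpan ⟨t, rfl⟩

end nMinus

theorem isLowestWeightVector_vertex : IsLowestWeightVector 1 (treeClass RTree.vertex) := by
  refine ⟨?_, mem_weightSpace.2 ?_, fun x hx => nMinus_lie_eq_zero Dminus_lie_vertex hx⟩
  · rw [← treeBasis_apply]
    exact treeBasis.ne_zero _
  · rw [dElt_lie_treeClass, size_vertex, Nat.cast_one]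

/-- Such a vector would be a non-zero multiple of `•`, on which `d` has eigenvalue `1`. -/
theorem not_isLowestWeightVector {n : ℕ} (hn : 1 < n) (w : TreeQuot) :
    ¬ IsLowestWeightVector (n : ℂ) w := by
  rintro ⟨h0, hw, h⟩
  obtain ⟨c, rfl⟩ := Submodule.mem_span_singleton.1 <|
    mem_span_vertex_of_Dminus_lie_eq_zero fun t => h _ (Dminus_mem_nMinus t)
  have h1 := mem_weightSpace.1 hw
  rw [lie_smul, dElt_lie_treeClass, size_vertex, Nat.cast_one, one_smul] at h1
  have h2 : ((n : ℂ) - 1) • (c • treeClass RTree.vertex) = 0 := by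
    rw [sub_smul, one_smul, ← h1, sub_self]
  have h3 := (smul_eq_zero.1 h2).resolve_right h0
  rw [sub_eq_zero] at h3
  exact hn.ne' (by exact_mod_cast h3)

/-- The part cut off has at least one vertex, so the remaining tree is strictly smaller. -/
theorem Dminus_lie_mem_degreeLT (t : RTree) {n : ℕ} {x : TreeQuot}
    (hx : x ∈ degreeLT treeBasis size (n + 1)) : ⁅Dminus t, x⁆ ∈ degreeLT treeBasis size n := by
  refine map_mem_degreeLT treeBasis size (k := n) (l := 0)
    (LieModule.toEnd ℂ InsElim TreeQuot (Dminus t)) (fun i => ?_) hx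
  rw [LieModule.toEnd_apply_apply, treeBasis_apply, Dminus_lie_treeClass]
  refine multiset_sum_mem _ fun y hy => ?_
  obtain ⟨c, hc, rfl⟩ := Multiset.mem_map.1 hy
  split_ifs
  · rw [← treeBasis_apply]
    have := size_of_mem_graft ((mem_cuts_iff _ _ _).1 hc)
    have := size_pos c.2
    exact basis_mem_degreeLT _ _ (by omega)
  · exact Submodule.zero_mem _

/-- A non-zero subrepresentation of `M` contains `•`. -/
theorem vertex_mem_of_ne_bot {N : LieSubmodule ℂ InsElim TreeQuot} (hN : N ≠ ⊥) :
    treeClass RTree.vertex ∈ N := by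
  classical
  -- A non-zero vector of `N` with the least bound on the sizes of its trees is killed by every
  -- `D⁻_t`, since its images lie in `N` and have a smaller bound.
  have hex : ∃ n, ∃ x ∈ N, x ≠ 0 ∧ x ∈ degreeLT treeBasis size n := by
    obtain ⟨x, hx, hx0⟩ := lieSubmodule_ne_bot_iff.1 hN
    obtain ⟨n, hn⟩ := exists_mem_degreeLT treeBasis size x
    exact ⟨n, x, hx, hx0, hn⟩
  obtain ⟨x, hx, hx0, hn⟩ := Nat.find_spec hex
  obtain ⟨m, hm⟩ : ∃ m, Nat.find hex = m + 1 := Nat.exists_eq_succ_of_ne_zero fun h => by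
    rw [h, degreeLT_zero] at hn
    exact hx0 hn
  rw [hm] at hn
  have hk : ∀ t, ⁅Dminus t, x⁆ = 0 := fun t => by
    by_contra h
    exact Nat.find_min hex (by omega : m < Nat.find hex)
      ⟨_, LieSubmodule.lie_mem _ hx, h, Dminus_lie_mem_degreeLT t hn⟩
  obtain ⟨c, rfl⟩ := Submodule.mem_span_singleton.1 (mem_span_vertex_of_Dminus_lie_eq_zero hk)
  have hc : c ≠ 0 := fun h => hx0 (by rw [h, zero_smul])
  have := N.smul_mem c⁻¹ hx
  rwa [inv_smul_smul₀ hc] at this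

/-! ### Products of the `D⁺_t` applied to `•` -/

/-- Grafting at the root accounts for `join t s`; the other terms have exactly `rootDegree s`
branches, one fewer than `join t s`. -/
theorem Dplus_lie_sub_join_mem (t s : RTree) :
    ⁅Dplus t, treeClass s⁆ - treeClass (join t s) ∈
      degreeLT treeBasis rootDegree (rootDegree s + 1) := by
  obtain ⟨m, hm, h⟩ := graft_eq_cons t s
  rw [Dplus_lie_treeClass, hm, Multiset.map_cons, Multiset.sum_cons, add_sub_cancel_left]
  refine multiset_sum_mem _ fun y hy => ?_
  obtain ⟨u, hu, rfl⟩ := Multiset.mem_map.1 hy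
  rw [← treeBasis_apply]
  exact basis_mem_degreeLT _ _ (by rw [h u hu]; omega)

theorem Dplus_lie_mem_degreeLT (t : RTree) {n : ℕ} {x : TreeQuot}
    (hx : x ∈ degreeLT treeBasis rootDegree n) :
    ⁅Dplus t, x⁆ ∈ degreeLT treeBasis rootDegree (n + 1) := by
  -- The bound `0` leaves only the zero vector and is treated apart, as `map_mem_degreeLT` needs a
  -- bound of the form `k + 1`.
  obtain _ | n := n
  · rw [degreeLT_zero, Submodule.mem_bot] at hx
    rw [hx, lie_zero]
    exact Submodule.zero_mem _
  refine map_mem_degreeLT treeBasis rootDegree (k := n) (l := 2)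
    (LieModule.toEnd ℂ InsElim TreeQuot (Dplus t)) (fun i => ?_) hx
  rw [LieModule.toEnd_apply_apply, treeBasis_apply,
    ← sub_add_cancel ⁅Dplus t, treeClass i⁆ (treeClass (join t i))]
  refine Submodule.add_mem _ (degreeLT_mono _ _ (by omega) (Dplus_lie_sub_join_mem t i)) ?_
  rw [← treeBasis_apply]
  exact basis_mem_degreeLT _ _ (by rw [rootDegree_join]; omega)

theorem applyPlus_append {V : Type} [AddCommGroup V] [LieRingModule InsElim V] (l : List RTree)
    (t : RTree) (w : V) : applyPlus (l ++ [t]) w = ⁅Dplus t, applyPlus l w⁆ := by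
  simp [applyPlus]

theorem addRoot_append (l : List RTree) (t : RTree) :
    addRoot (l ++ [t] : List RTree) = join t (addRoot l) := by
  rw [← addRoot_cons, Multiset.cons_coe]
  exact congrArg addRoot (Multiset.coe_eq_coe.2 (List.perm_append_singleton t l))

/-- Up to trees with fewer branches at the root, `D⁺_{t_k} ⋯ D⁺_{t_1} •` is the tree with the
branches `t_1, …, t_k`. -/
theorem applyPlus_vertex_sub_addRoot_mem (l : List RTree) :
    applyPlus l (treeClass RTree.vertex) - treeClass (addRoot l) ∈
      degreeLT treeBasis rootDegree l.length := by
  induction l using List.reverseRecOn with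
  | nil =>
    change treeClass RTree.vertex - treeClass RTree.vertex ∈ _
    rw [sub_self]
    exact Submodule.zero_mem _
  | append_singleton l t ih =>
    have hd : rootDegree (addRoot l) = l.length := by
      rw [rootDegree, branches_addRoot, Multiset.coe_card]
    -- There are two errors: `D⁺_t` applied to the error of the shorter word, and the error of
    -- `D⁺_t` on its leading tree. Both have fewer than `l.length + 1` branches.
    have h1 := Dplus_lie_mem_degreeLT t ih
    have h2 := Dplus_lie_sub_join_mem t (addRoot l)
    rw [lie_sub] at h1
    rw [hd] at h2
    have := Submodule.add_mem _ h1 h2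
    rw [sub_add_sub_cancel] at this
    rw [applyPlus_append, addRoot_append, List.length_append, List.length_singleton]
    exact this

/-! ### Generation of `𝔤` and the relations in `𝔤` -/

theorem mk_eq_mk_of_relation {x y : FreeLieAlgebra ℂ Gen} (h : Relation x y) :
    (LieSubmodule.Quotient.mk x : InsElim) = LieSubmodule.Quotient.mk y :=
  (Submodule.Quotient.eq _).2 (LieSubmodule.subset_lieSpan ⟨x, y, h, rfl⟩)

/-- A Lie subalgebra of `𝔤` containing the generators is all of `𝔤`. -/
theorem mem_of_gen_mem (K : LieSubalgebra ℂ InsElim) (hK : ∀ g, gen g ∈ K) (x : InsElim) :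
    x ∈ K := by
  let π : FreeLieAlgebra ℂ Gen →ₗ⁅ℂ⁆ InsElim :=
    { (LieSubmodule.Quotient.mk' relationIdeal : FreeLieAlgebra ℂ Gen →ₗ[ℂ] InsElim) with
      map_lie' := fun {x y} => LieSubmodule.Quotient.mk_bracket _ x y }
  -- The universal property of the free Lie algebra lifts the projection to `K`: the two maps to `𝔤`
  -- agree on generators.
  let F : FreeLieAlgebra ℂ Gen →ₗ⁅ℂ⁆ K := FreeLieAlgebra.lift ℂ fun g => ⟨gen g, hK g⟩
  have hF : K.incl.comp F = π := by
    refine FreeLieAlgebra.hom_ext fun g => ?_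
    rw [LieHom.comp_apply, FreeLieAlgebra.lift_of_apply]
    rfl
  induction x using Submodule.Quotient.induction_on with
  | H z =>
    change π z ∈ K
    rw [← hF]
    exact (F z).2

theorem mk_sub_mem_span {S : Submodule ℂ InsElim} {x y : FreeLieAlgebra ℂ Gen}
    (hx : (LieSubmodule.Quotient.mk x : InsElim) ∈ S)
    (hy : (LieSubmodule.Quotient.mk y : InsElim) ∈ S) :
    (LieSubmodule.Quotient.mk (x - y) : InsElim) ∈ S :=
  S.sub_mem hx hy

theorem mk_multiset_sum_mem {S : Submodule ℂ InsElim} {X : Type} (m : Multiset X)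
    (f : X → FreeLieAlgebra ℂ Gen)
    (h : ∀ x, (LieSubmodule.Quotient.mk (f x) : InsElim) ∈ S) :
    (LieSubmodule.Quotient.mk (m.map f).sum : InsElim) ∈ S := by
  have := multiset_sum_mem (S := S.comap
    (LieSubmodule.Quotient.mk' relationIdeal : FreeLieAlgebra ℂ Gen →ₗ[ℂ] InsElim)) (m.map f)
    (fun y hy => by
      obtain ⟨x, _, rfl⟩ := Multiset.mem_map.1 hy
      exact h x)
  exact this

theorem mk_nsmul_mem {S : Submodule ℂ InsElim} (n : ℕ) {x : FreeLieAlgebra ℂ Gen}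
    (h : (LieSubmodule.Quotient.mk x : InsElim) ∈ S) :
    (LieSubmodule.Quotient.mk (n • x) : InsElim) ∈ S := by
  have := (S.comap (LieSubmodule.Quotient.mk' relationIdeal :
    FreeLieAlgebra ℂ Gen →ₗ[ℂ] InsElim)).nsmul_mem (x := x) h n
  exact this

/-- Reordering words uses only that a commutator of two `D⁺`'s is a combination of single `D⁺`'s;
the coefficients do not matter. -/
theorem Dplus_lie_Dplus_mem (t₁ t₂ : RTree) :
    ⁅Dplus t₁, Dplus t₂⁆ ∈ Submodule.span ℂ (Set.range Dplus) := by
  have h : ∀ t, Dplus t ∈ Submodule.span ℂ (Set.range Dplus) := fun t =>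
    Submodule.subset_span ⟨t, rfl⟩
  have e := mk_eq_mk_of_relation (Relation.plus_plus t₁ t₂)
  rw [LieSubmodule.Quotient.mk_bracket] at e
  refine (congrArg (· ∈ Submodule.span ℂ (Set.range Dplus)) e).mpr ?_
  exact mk_sub_mem_span (mk_multiset_sum_mem _ _ h) (mk_multiset_sum_mem _ _ h)

/-- This is all that is needed to move a `D⁻` through a word in the `D⁺`'s towards the lowest-weight
vector. -/
theorem Dminus_lie_Dplus_mem (t₁ t₂ : RTree) :
    ⁅Dminus t₁, Dplus t₂⁆ ∈ Submodule.span ℂ (Set.range gen) := by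
  have h : ∀ g, gen g ∈ Submodule.span ℂ (Set.range gen) := fun g =>
    Submodule.subset_span ⟨g, rfl⟩
  by_cases ht : t₁ = t₂
  · subst ht
    have e := mk_eq_mk_of_relation (Relation.minus_plus_self t₁)
    rw [LieSubmodule.Quotient.mk_bracket] at e
    exact (congrArg (· ∈ Submodule.span ℂ (Set.range gen)) e).mpr (h Gen.d)
  · have e := mk_eq_mk_of_relation (Relation.minus_plus t₁ t₂ ht)
    rw [LieSubmodule.Quotient.mk_bracket] at e
    refine (congrArg (· ∈ Submodule.span ℂ (Set.range gen)) e).mpr ?_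
    exact Submodule.add_mem _
      (mk_multiset_sum_mem _ _ fun t => mk_nsmul_mem _ (h (Gen.plus t)))
      (mk_multiset_sum_mem _ _ fun t => mk_nsmul_mem _ (h (Gen.minus t)))

theorem dElt_lie_Dplus (t : RTree) : ⁅dElt, Dplus t⁆ = (size t : ℂ) • Dplus t := by
  have e := mk_eq_mk_of_relation (Relation.d_plus t)
  rw [LieSubmodule.Quotient.mk_bracket] at e
  exact e

/-! ### Subrepresentations generated by a lowest-weight vector -/

section Words

variable {V : Type} [AddCommGroup V] [Module ℂ V] [LieRingModule InsElim V]

/-- The span of the vectors `D⁺_{t_k} ⋯ D⁺_{t_1} v` with `k ≤ n`. -/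
def wordSpan (v : V) (n : ℕ) : Submodule ℂ V :=
  Submodule.span ℂ ((fun l => applyPlus l v) '' {l | l.length ≤ n})

theorem applyPlus_mem_wordSpan (v : V) {l : List RTree} {n : ℕ} (h : l.length ≤ n) :
    applyPlus l v ∈ wordSpan v n :=
  Submodule.subset_span ⟨l, h, rfl⟩

theorem wordSpan_mono (v : V) {m n : ℕ} (h : m ≤ n) : wordSpan v m ≤ wordSpan v n :=
  Submodule.span_mono (Set.image_mono fun _ hl => le_trans hl h)

variable [LieModule ℂ InsElim V]

/-- The elements of `𝔤` that preserve `S` form a Lie subalgebra. -/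
theorem lie_mem_of_gen_lie_mem (S : Submodule ℂ V) (h : ∀ g, ∀ w ∈ S, ⁅gen g, w⁆ ∈ S)
    (x : InsElim) {w : V} (hw : w ∈ S) : ⁅x, w⁆ ∈ S := by
  let K : LieSubalgebra ℂ InsElim :=
    { carrier := {x | ∀ w ∈ S, ⁅x, w⁆ ∈ S}
      add_mem' := fun hx hy w hw => by
        rw [add_lie]
        exact S.add_mem (hx w hw) (hy w hw)
      zero_mem' := fun w _ => by
        rw [zero_lie]
        exact S.zero_mem
      smul_mem' := fun c x hx w hw => by
        rw [smul_lie]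
        exact S.smul_mem c (hx w hw)
      lie_mem' := fun hx hy w hw => by
        rw [lie_lie]
        exact S.sub_mem (hx _ (hy w hw)) (hy _ (hx w hw)) }
  exact mem_of_gen_mem K h x w hw

theorem lie_mem_of_mem_span {A : Set InsElim} (S : Submodule ℂ V) {w : V}
    (h : ∀ a ∈ A, ⁅a, w⁆ ∈ S) {x : InsElim} (hx : x ∈ Submodule.span ℂ A) : ⁅x, w⁆ ∈ S := by
  induction hx using Submodule.span_induction with
  | mem x hx => exact h x hx
  | zero => rw [zero_lie]; exact S.zero_mem
  | add x y _ _ hx hy => rw [add_lie]; exact S.add_mem hx hy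
  | smul c x _ hx => rw [smul_lie]; exact S.smul_mem c hx

theorem lie_mem_of_forall_mem {A : Set V} (S : Submodule ℂ V) {x : InsElim}
    (h : ∀ w ∈ A, ⁅x, w⁆ ∈ S) {w : V} (hw : w ∈ Submodule.span ℂ A) : ⁅x, w⁆ ∈ S :=
  (Submodule.span_le (p := S.comap (LieModule.toEnd ℂ InsElim V x))).2 h hw

theorem Dplus_lie_mem_wordSpan {v w : V} {n : ℕ} (t : RTree) (hw : w ∈ wordSpan v n) :
    ⁅Dplus t, w⁆ ∈ wordSpan v (n + 1) := by
  refine lie_mem_of_forall_mem _ ?_ hw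
  rintro _ ⟨l, hl, rfl⟩
  rw [← applyPlus_append]
  have hl' : l.length ≤ n := hl
  exact applyPlus_mem_wordSpan v (by simpa using hl')

/-- Changing the order of the factors changes the product by shorter products. -/
theorem applyPlus_reverse_sub_mem_wordSpan (v : V) {l l' : List RTree} (h : l.Perm l') {n : ℕ}
    (hn : l.length ≤ n + 1) : applyPlus l.reverse v - applyPlus l'.reverse v ∈ wordSpan v n := by
  -- `applyPlus` applies the last entry of a list outermost, whereas permutations are built at the
  -- head; the reversal makes the two match.
  induction h generalizing n with
  | nil => rw [sub_self]; exact Submodule.zero_mem _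
  | @cons t l l' h ih =>
    rw [List.reverse_cons, List.reverse_cons, applyPlus_append, applyPlus_append, ← lie_sub]
    obtain _ | n := n
    · have hl : l = [] := by simpa using hn
      subst hl
      rw [h.nil_eq, sub_self, lie_zero]
      exact Submodule.zero_mem _
    · exact Dplus_lie_mem_wordSpan t (ih (by simpa using hn))
  | swap a b l =>
    -- The difference is `[D⁺_b, D⁺_a]` applied to a common word, so two factors are replaced by
    -- one.
    simp only [List.reverse_cons, applyPlus_append]
    rw [← lie_lie]
    have hn' : l.reverse.length + 1 ≤ n := by simpa using hn
    refine lie_mem_of_mem_span _ ?_ (Dplus_lie_Dplus_mem b a)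
    rintro _ ⟨t, rfl⟩
    exact wordSpan_mono v hn' (Dplus_lie_mem_wordSpan t (applyPlus_mem_wordSpan v le_rfl))
  | @trans l₁ l₂ l₃ h h' ih ih' =>
    rw [← sub_add_sub_cancel _ (applyPlus l₂.reverse v)]
    exact Submodule.add_mem _ (ih hn) (ih' (h.length_eq ▸ hn))

/-- A submodule containing one product for each forest contains all products. -/
theorem applyPlus_mem_of_forall_forest (v : V) (S : Submodule ℂ V)
    (h : ∀ F : Forest, ∃ l : List RTree, (l : Forest) = F ∧ applyPlus l v ∈ S) (l : List RTree) :
    applyPlus l v ∈ S := by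
  -- Induction on the length: a word differs from the chosen word of its forest by shorter words,
  -- which already lie in `S`.
  have key : ∀ n, wordSpan v n ≤ S := by
    intro n
    induction n with
    | zero =>
      refine Submodule.span_le.2 ?_
      rintro _ ⟨l, hl, rfl⟩
      have hl' : l = [] := by simpa using hl
      obtain ⟨l₀, h₀, h₁⟩ := h 0
      rw [Multiset.coe_eq_zero] at h₀
      rw [hl']
      rwa [h₀] at h₁
    | succ n ih =>
      refine Submodule.span_le.2 ?_
      rintro _ ⟨l, hl, rfl⟩
      have hl' : l.length ≤ n + 1 := hl
      obtain ⟨l₀, h₀, h₁⟩ := h l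
      have hp : l.reverse.Perm l₀.reverse :=
        (l.reverse_perm.trans (Multiset.coe_eq_coe.1 h₀).symm).trans l₀.reverse_perm.symm
      have := ih (applyPlus_reverse_sub_mem_wordSpan v hp (by simpa using hl'))
      rw [List.reverse_reverse, List.reverse_reverse] at this
      exact (S.sub_mem_iff_left h₁).1 this
  exact key l.length (applyPlus_mem_wordSpan v le_rfl)

theorem dElt_lie_applyPlus {v : V} {δ : ℂ} (hd : ⁅dElt, v⁆ = δ • v) (l : List RTree) :
    ⁅dElt, applyPlus l v⁆ = (δ + forestSize l) • applyPlus l v := by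
  induction l using List.reverseRecOn with
  | nil =>
    change ⁅dElt, v⁆ = (δ + (forestSize 0 : ℕ)) • v
    rw [hd, forestSize, Multiset.map_zero, Multiset.sum_zero, Nat.cast_zero, add_zero]
  | append_singleton l t ih =>
    have hs : forestSize (l ++ [t] : List RTree) = forestSize l + size t := by
      simp [forestSize]
    rw [applyPlus_append, leibniz_lie, dElt_lie_Dplus, ih, smul_lie, lie_smul, ← add_smul, hs,
      Nat.cast_add]
    congr 1
    ring

/-- The products `D⁺_{t_k} ⋯ D⁺_{t_1} v` span a subrepresentation if `v` is an eigenvector of `d`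
killed by `𝔫₋`. -/
theorem gen_lie_mem_span_applyPlus {v : V} {δ : ℂ} (hd : ⁅dElt, v⁆ = δ • v)
    (hm : ∀ t, ⁅Dminus t, v⁆ = 0) (g : Gen) :
    ∀ w ∈ Submodule.span ℂ (Set.range fun l => applyPlus l v),
      ⁅gen g, w⁆ ∈ Submodule.span ℂ (Set.range fun l => applyPlus l v) := by
  set S := Submodule.span ℂ (Set.range fun l => applyPlus l v) with hS
  have hw : ∀ l, applyPlus l v ∈ S := fun l => Submodule.subset_span ⟨l, rfl⟩
  have hplus : ∀ t, ∀ w ∈ S, ⁅Dplus t, w⁆ ∈ S := fun t w => by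
    refine lie_mem_of_forall_mem S ?_
    rintro _ ⟨l, rfl⟩
    rw [← applyPlus_append]
    exact hw _
  have hdl : ∀ l, ⁅dElt, applyPlus l v⁆ ∈ S := fun l => by
    rw [dElt_lie_applyPlus hd]
    exact S.smul_mem _ (hw l)
  -- The claim is proved for all `t` at once, since commuting `D⁻_t` past `D⁺_s` may produce other
  -- `D⁻`'s acting on the shorter word.
  have hminus : ∀ l t, ⁅Dminus t, applyPlus l v⁆ ∈ S := by
    intro l
    induction l using List.reverseRecOn with
    | nil =>
      intro t
      change ⁅Dminus t, v⁆ ∈ S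
      rw [hm]
      exact S.zero_mem
    | append_singleton l s ih =>
      intro t
      rw [applyPlus_append, leibniz_lie]
      refine S.add_mem (lie_mem_of_mem_span S ?_ (Dminus_lie_Dplus_mem t s)) (hplus s _ (ih t))
      rintro _ ⟨t | t | _, rfl⟩
      · exact hplus t _ (hw l)
      · exact ih t
      · exact hdl l
  intro w
  refine lie_mem_of_forall_mem S ?_
  rintro _ ⟨l, rfl⟩
  obtain t | t | _ := g
  · exact hplus t _ (hw l)
  · exact hminus l t
  · exact hdl l

end Words

/-! ### Verma modules -/

/-- The elements of `U(𝔤)` that preserve `S` form a subalgebra `A` containing `𝔤`. By the universal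
property the identity of `U(𝔤)` factors through `A`, so `A` is everything. -/
theorem enveloping_smul_mem {δ : ℂ} (S : Submodule ℂ (Verma δ))
    (h : ∀ x : InsElim, ∀ w ∈ S, ⁅x, w⁆ ∈ S) (u : UniversalEnvelopingAlgebra ℂ InsElim)
    {w : Verma δ} (hw : w ∈ S) : u • w ∈ S := by
  let A : Subalgebra ℂ (UniversalEnvelopingAlgebra ℂ InsElim) :=
    { carrier := {u | ∀ w ∈ S, u • w ∈ S}
      mul_mem' := fun {a b} ha hb w hw => by
        rw [mul_smul]
        exact ha _ (hb w hw)
      add_mem' := fun {a b} ha hb w hw => by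
        rw [add_smul]
        exact S.add_mem (ha w hw) (hb w hw)
      algebraMap_mem' := fun c w hw => by
        rw [algebraMap_smul]
        exact S.smul_mem c hw }
  let : LieRing (UniversalEnvelopingAlgebra ℂ InsElim) := LieRing.ofAssociativeRing
  let : LieRing A := LieRing.ofAssociativeRing
  let : LieAlgebra ℂ A := LieAlgebra.ofAssociativeAlgebra
  let f : InsElim →ₗ⁅ℂ⁆ A :=
    { toFun := fun x => ⟨UniversalEnvelopingAlgebra.ι ℂ x, h x⟩
      map_add' := fun x y => Subtype.ext (map_add _ x y)
      map_smul' := fun c x => Subtype.ext (map_smul _ c x)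
      map_lie' := fun {x y} => Subtype.ext (LieHom.map_lie (UniversalEnvelopingAlgebra.ι ℂ) x y) }
  have hf : A.val.comp (UniversalEnvelopingAlgebra.lift ℂ f) = AlgHom.id ℂ _ := by
    refine UniversalEnvelopingAlgebra.hom_ext ℂ (LieHom.ext fun x => ?_)
    change A.val (UniversalEnvelopingAlgebra.lift ℂ f (UniversalEnvelopingAlgebra.ι ℂ x)) = _
    rw [UniversalEnvelopingAlgebra.lift_ι_apply]
    rfl
  have hu := congrArg (fun g => g u) hf
  have : u ∈ A := by
    rw [← show A.val (UniversalEnvelopingAlgebra.lift ℂ f u) = u from hu]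
    exact Subtype.prop _
  exact this w hw

/-- The class of `u` is `u • v`, so `v` generates `W(δ)`. This serves as an induction principle for
Verma modules. -/
theorem mem_of_vermaVector_mem {δ : ℂ} (S : Submodule ℂ (Verma δ))
    (h : ∀ g, ∀ w ∈ S, ⁅gen g, w⁆ ∈ S) (hv : vermaVector δ ∈ S) (w : Verma δ) : w ∈ S := by
  induction w using Submodule.Quotient.induction_on with
  | H u =>
    have := enveloping_smul_mem S (fun x w hw => lie_mem_of_gen_lie_mem S h x hw) u hv
    rwa [vermaVector, ← Submodule.Quotient.mk_smul, smul_eq_mul, mul_one] at this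

theorem nMinus_lie_vermaVector {δ : ℂ} {x : InsElim} (hx : x ∈ nMinus) :
    ⁅x, vermaVector δ⁆ = 0 := by
  change UniversalEnvelopingAlgebra.ι ℂ x • vermaVector δ = 0
  rw [vermaVector, ← Submodule.Quotient.mk_smul, smul_eq_mul, mul_one,
    Submodule.Quotient.mk_eq_zero]
  exact Ideal.subset_span (Or.inl ⟨x, hx, rfl⟩)

theorem dElt_lie_vermaVector (δ : ℂ) : ⁅dElt, vermaVector δ⁆ = δ • vermaVector δ := by
  change UniversalEnvelopingAlgebra.ι ℂ dElt • vermaVector δ = _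
  rw [← algebraMap_smul (UniversalEnvelopingAlgebra ℂ InsElim) δ (vermaVector δ), ← sub_eq_zero,
    ← sub_smul, vermaVector, ← Submodule.Quotient.mk_smul, smul_eq_mul, mul_one,
    Submodule.Quotient.mk_eq_zero]
  exact Ideal.subset_span (Or.inr rfl)

theorem applyPlus_span_eq_top (δ : ℂ) :
    Submodule.span ℂ (Set.range fun l => applyPlus l (vermaVector δ)) = ⊤ :=
  eq_top_iff.2 fun w _ => mem_of_vermaVector_mem _
    (gen_lie_mem_span_applyPlus (dElt_lie_vermaVector δ)
      fun t => nMinus_lie_vermaVector (Dminus_mem_nMinus t))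
    (Submodule.subset_span (Set.mem_range_self ([] : List RTree))) w

/-- The order enters only by selecting one word for each forest. This is the spanning half of the
basis statement, valid for every `δ`. -/
theorem forestVector_span_eq_top (r : RTree → RTree → Prop) [DecidableRel r] [IsTrans RTree r]
    [Std.Antisymm r] [Std.Total r] (δ : ℂ) :
    Submodule.span ℂ (Set.range (forestVector r δ)) = ⊤ := by
  rw [eq_top_iff, ← applyPlus_span_eq_top, Submodule.span_le]
  rintro _ ⟨l, rfl⟩
  exact applyPlus_mem_of_forall_forest _ _
    (fun F => ⟨F.sort r, Multiset.sort_eq _ _, Submodule.subset_span (Set.mem_range_self F)⟩) l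

/-! ### The universal property of Verma modules -/

section Universal

variable {V : Type} [AddCommGroup V] [Module ℂ V] [LieRingModule InsElim V]

theorem map_applyPlus {W : Type} [AddCommGroup W] [Module ℂ W] [LieRingModule InsElim W]
    (φ : V →ₗ⁅ℂ,InsElim⁆ W) (l : List RTree) (v : V) :
    φ (applyPlus l v) = applyPlus l (φ v) := by
  induction l using List.reverseRecOn with
  | nil => rfl
  | append_singleton l t ih =>
    rw [applyPlus_append, applyPlus_append, LieModuleHom.map_lie, ih]

theorem verma_hom_ext {δ : ℂ} {φ ψ : Verma δ →ₗ⁅ℂ,InsElim⁆ V}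
    (h : φ (vermaVector δ) = ψ (vermaVector δ)) : φ = ψ := by
  refine LieModuleHom.ext fun w => ?_
  refine mem_of_vermaVector_mem
    (LinearMap.eqLocus (φ : Verma δ →ₗ[ℂ] V) (ψ : Verma δ →ₗ[ℂ] V)) (fun g w hw => ?_) h w
  have hw' : φ w = ψ w := hw
  change φ ⁅gen g, w⁆ = ψ ⁅gen g, w⁆
  rw [LieModuleHom.map_lie, LieModuleHom.map_lie, hw']

variable [LieModule ℂ InsElim V]

/-- The annihilator of `v` in `U(𝔤)` is a left ideal containing the generators of `vermaIdeal δ`, so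
`u ↦ u v` descends to the quotient. -/
theorem exists_verma_hom {δ : ℂ} {v : V} (hd : ⁅dElt, v⁆ = δ • v) (hm : ∀ x ∈ nMinus, ⁅x, v⁆ = 0) :
    ∃ φ : Verma δ →ₗ⁅ℂ,InsElim⁆ V, φ (vermaVector δ) = v := by
  let A : UniversalEnvelopingAlgebra ℂ InsElim →ₐ[ℂ] Module.End ℂ V :=
    UniversalEnvelopingAlgebra.lift ℂ (LieModule.toEnd ℂ InsElim V)
  have hA : ∀ x, A (UniversalEnvelopingAlgebra.ι ℂ x) = LieModule.toEnd ℂ InsElim V x := fun x =>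
    UniversalEnvelopingAlgebra.lift_ι_apply ℂ _ x
  let I : Ideal (UniversalEnvelopingAlgebra ℂ InsElim) :=
    { carrier := {u | A u v = 0}
      add_mem' := fun {a b} ha hb => by
        change A (a + b) v = 0
        rw [map_add, LinearMap.add_apply, ha, hb, add_zero]
      zero_mem' := by
        change A 0 v = 0
        rw [map_zero, LinearMap.zero_apply]
      smul_mem' := fun a b hb => by
        change A (a * b) v = 0
        rw [map_mul, Module.End.mul_apply, hb, map_zero] }
  have hI : vermaIdeal δ ≤ I := by
    refine Ideal.span_le.2 ?_
    rintro _ (⟨x, hx, rfl⟩ | rfl)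
    · change A _ v = 0
      rw [hA]
      exact hm x hx
    · change A _ v = 0
      rw [map_sub, hA, AlgHom.commutes, LinearMap.sub_apply, LieModule.toEnd_apply_apply, hd,
        Module.algebraMap_end_apply, sub_self]
  let f : Verma δ →ₗ[ℂ] V :=
    (((vermaIdeal δ).restrictScalars ℂ).liftQ (LinearMap.applyₗ v ∘ₗ A.toLinearMap) hI) ∘ₗ
      (Submodule.Quotient.restrictScalarsEquiv ℂ (vermaIdeal δ)).symm.toLinearMap
  have hf : ∀ u, f (Submodule.Quotient.mk u) = A u v := fun _ => rfl
  refine ⟨{ f with map_lie' := ?_ }, ?_⟩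
  · intro x w
    induction w using Submodule.Quotient.induction_on with
    | H u =>
      change f (Submodule.Quotient.mk (UniversalEnvelopingAlgebra.ι ℂ x * u)) =
        ⁅x, f (Submodule.Quotient.mk u)⁆
      rw [hf, hf, map_mul, hA]
      rfl
  · change f (Submodule.Quotient.mk 1) = v
    rw [hf, map_one]
    rfl

end Universal

/-! ### Comparison of `W(1)` with `M` -/

section Order

variable (r : RTree → RTree → Prop) [DecidableRel r] [IsTrans RTree r] [Std.Antisymm r]
  [Std.Total r]

/-- The linear map `M → W(1)` sending `B(F)` to `D⁺_F v`. -/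
noncomputable def treeToVerma : TreeQuot →ₗ[ℂ] Verma 1 :=
  treeBasis.constr ℂ fun t => forestVector r 1 (branches t)

theorem treeToVerma_treeClass (t : RTree) :
    treeToVerma r (treeClass t) = forestVector r 1 (branches t) := by
  rw [← treeBasis_apply, treeToVerma, Basis.constr_basis]

theorem treeToVerma_surjective : Function.Surjective (treeToVerma r) := by
  rw [← LinearMap.range_eq_top, eq_top_iff, ← forestVector_span_eq_top r, Submodule.span_le]
  rintro _ ⟨F, rfl⟩
  exact ⟨treeClass (addRoot F), by rw [treeToVerma_treeClass, branches_addRoot]⟩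

/-- The composite sends `B(F)` to the ordered product of the `D⁺`'s of `F` applied to `•`, which is
`B(F)` plus trees with fewer branches. -/
theorem comp_treeToVerma_bijective {φ : Verma 1 →ₗ⁅ℂ,InsElim⁆ TreeQuot}
    (hφ : φ (vermaVector 1) = treeClass RTree.vertex) :
    Function.Bijective ((φ : Verma 1 →ₗ[ℂ] TreeQuot) ∘ₗ treeToVerma r) := by
  refine bijective_of_unitriangular treeBasis rootDegree _ fun t => ?_
  have h := applyPlus_vertex_sub_addRoot_mem ((branches t).sort r)
  rw [Multiset.length_sort, Multiset.sort_eq, addRoot_branches, ← hφ, ← map_applyPlus] at h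
  rw [LinearMap.comp_apply, treeBasis_apply, treeToVerma_treeClass]
  exact h

/-- Surjectivity is the spanning of `W(1)` by the `D⁺_F v`; injectivity, inherited from the
composite with `φ`, is their linear independence. -/
theorem treeToVerma_bijective : Function.Bijective (treeToVerma r) := by
  obtain ⟨φ, hφ⟩ := exists_verma_hom (mem_weightSpace.1 isLowestWeightVector_vertex.2.1)
    isLowestWeightVector_vertex.2.2
  refine ⟨Function.Injective.of_comp (f := φ) ?_, treeToVerma_surjective r⟩
  exact (comp_treeToVerma_bijective r hφ).1

theorem verma_hom_bijective {φ : Verma 1 →ₗ⁅ℂ,InsElim⁆ TreeQuot}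
    (hφ : φ (vermaVector 1) = treeClass RTree.vertex) : Function.Bijective φ := by
  classical
  -- The statement involves no order, so an arbitrary one is chosen.
  let : LinearOrder RTree := IsWellOrder.linearOrder WellOrderingRel
  have h := comp_treeToVerma_bijective (· ≤ ·) hφ
  exact (Function.Bijective.of_comp_iff φ (treeToVerma_bijective (· ≤ ·))).1 h

/-- The basis of `W(1)` consisting of the vectors `D⁺_F v`. -/
noncomputable def forestBasis : Basis Forest ℂ (Verma 1) :=
  (treeBasis.map (LinearEquiv.ofBijective _ (treeToVerma_bijective r))).reindex addRootEquiv.symm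

theorem forestBasis_apply (F : Forest) : forestBasis r F = forestVector r 1 F := by
  rw [forestBasis, Basis.reindex_apply, Basis.map_apply, Equiv.symm_symm, treeBasis_apply,
    LinearEquiv.ofBijective_apply, treeToVerma_treeClass]
  exact congrArg _ (branches_addRoot F)

theorem dElt_lie_forestBasis (F : Forest) :
    ⁅dElt, forestBasis r F⁆ = ((forestSize F + 1 : ℕ) : ℂ) • forestBasis r F := by
  rw [forestBasis_apply, forestVector, dElt_lie_applyPlus (dElt_lie_vermaVector 1),
    Multiset.sort_eq, Nat.cast_add, Nat.cast_one, add_comm]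

end Order

/-! ### Bases of the weight spaces, and irreducibility of `M` -/

theorem dElt_lie_treeBasis (t : RTree) : ⁅dElt, treeBasis t⁆ = (size t : ℂ) • treeBasis t := by
  rw [treeBasis_apply, dElt_lie_treeClass]

theorem bijOn_addRoot (n : ℕ) :
    Set.BijOn addRoot {F : Forest | forestSize F + 1 = n} {t : RTree | RTree.size t = n} := by
  refine ⟨fun F hF => (size_addRoot F).trans hF, addRootEquiv.injective.injOn, fun t ht => ?_⟩
  refine ⟨branches t, ?_, addRoot_branches t⟩
  change forestSize (branches t) + 1 = n
  rw [← size_addRoot, addRoot_branches]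
  exact ht

/-- A basis of eigenvectors of `d` restricts to a basis of each eigenspace. -/
theorem linearIndependent_and_span_eq_weightSpace {ι V : Type} [AddCommGroup V] [Module ℂ V]
    [LieRingModule InsElim V] [LieModule ℂ InsElim V] (b : Basis ι ℂ V) (w : ι → ℕ)
    (hw : ∀ i, ⁅dElt, b i⁆ = (w i : ℂ) • b i) (n : ℕ) :
    LinearIndependent ℂ (fun i : {i // w i = n} => b i.1) ∧
      Submodule.span ℂ (Set.range fun i : {i // w i = n} => b i.1) = weightSpace V n := by
  refine ⟨b.linearIndependent.comp _ Subtype.val_injective, ?_⟩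
  rw [weightSpace_eq_span b w hw, Set.image_eq_range]
  rfl

/-- The linear isomorphism `D⁺_F v ↦ B(F)` maps eigenspaces of `d` onto eigenspaces of `d`. -/
theorem exists_linearEquiv_forestVector (r : RTree → RTree → Prop) [DecidableRel r]
    [IsTrans RTree r] [Std.Antisymm r] [Std.Total r] :
    ∃ e : Verma 1 ≃ₗ[ℂ] TreeQuot,
      (∀ F : Forest, e (forestVector r 1 F) = treeClass (addRoot F)) ∧
      ∀ n : ℕ, (weightSpace (Verma 1) n).map (e : Verma 1 →ₗ[ℂ] TreeQuot) =
        weightSpace TreeQuot n := by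
  -- This map matches bases and is only linear. It differs from the homomorphism `W(1) → M`, which
  -- adds trees with fewer branches: for `F` consisting of two copies of `•`, that homomorphism
  -- gives `B(F)` plus the path with three vertices.
  have he : ∀ F, (forestBasis r).equiv treeBasis addRootEquiv (forestBasis r F) =
      treeBasis (addRoot F) := fun F => Basis.equiv_apply _ _ _ _
  refine ⟨(forestBasis r).equiv treeBasis addRootEquiv, fun F => ?_, fun n => ?_⟩
  · rw [← forestBasis_apply, he, treeBasis_apply]
  · rw [weightSpace_eq_span _ _ (dElt_lie_forestBasis r),
      weightSpace_eq_span _ _ dElt_lie_treeBasis, Submodule.map_span, ← (bijOn_addRoot n).image_eq,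
      Set.image_image, Set.image_image]
    congr 1
    exact Set.image_congr fun F _ => he F

theorem vermaVector_ne_zero : vermaVector 1 ≠ 0 := by
  obtain ⟨φ, hφ⟩ := exists_verma_hom (mem_weightSpace.1 isLowestWeightVector_vertex.2.1)
    isLowestWeightVector_vertex.2.2
  intro h
  rw [h, map_zero] at hφ
  exact isLowestWeightVector_vertex.1 hφ.symm

theorem isLowestWeightVector_vermaVector : IsLowestWeightVector 1 (vermaVector 1) :=
  ⟨vermaVector_ne_zero, mem_weightSpace.2 (dElt_lie_vermaVector 1),
    fun _ hx => nMinus_lie_vermaVector hx⟩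

/-- A non-zero subrepresentation contains `•`, so its preimage under the surjection `W(1) → M`
contains the generator `v` and is everything. -/
theorem treeQuot_isIrreducible : LieModule.IsIrreducible ℂ InsElim TreeQuot := by
  have : Nontrivial TreeQuot := ⟨_, _, isLowestWeightVector_vertex.1⟩
  refine LieModule.IsIrreducible.mk fun N hN => eq_top_iff.2 fun x _ => ?_
  obtain ⟨φ, hφ⟩ := exists_verma_hom (mem_weightSpace.1 isLowestWeightVector_vertex.2.1)
    isLowestWeightVector_vertex.2.2
  obtain ⟨y, rfl⟩ := (verma_hom_bijective hφ).2 x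
  refine mem_of_vermaVector_mem (N.toSubmodule.comap (φ : Verma 1 →ₗ[ℂ] TreeQuot))
    (fun g w hw => ?_) ?_ y
  · change φ ⁅gen g, w⁆ ∈ N
    rw [LieModuleHom.map_lie]
    exact N.lie_mem hw
  · change φ (vermaVector 1) ∈ N
    rw [hφ]
    exact vertex_mem_of_ne_bot hN

end InsertionElimination

open InsertionElimination in
theorem mainTheorem5 :
    -- `•` is a lowest-weight vector of `M` of weight `1`, and `M_n` contains none for `n > 1`
    (IsLowestWeightVector 1 (treeClass RTree.vertex) ∧
      ∀ n : ℕ, 1 < n → ∀ w : TreeQuot, ¬ IsLowestWeightVector (n : ℂ) w) ∧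
    -- `M` is irreducible
    LieModule.IsIrreducible ℂ InsElim TreeQuot ∧
    -- the map `W(1) → M` sending the lowest-weight vector to `•` exists, is unique, and is an
    -- isomorphism; it maps `W(1)_n` onto `M_n`
    (IsLowestWeightVector 1 (vermaVector 1) ∧
      ∃ φ : Verma 1 →ₗ⁅ℂ,InsElim⁆ TreeQuot,
        φ (vermaVector 1) = treeClass RTree.vertex ∧
        (∀ ψ : Verma 1 →ₗ⁅ℂ,InsElim⁆ TreeQuot,
          ψ (vermaVector 1) = treeClass RTree.vertex → ψ = φ) ∧
        Function.Bijective φ ∧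
        ∀ n : ℕ, (weightSpace (Verma 1) n).map (φ : Verma 1 →ₗ[ℂ] TreeQuot) =
          weightSpace TreeQuot n) ∧
    -- for every order on the trees: the vectors `D⁺_F v`, for the forests `F` on `n - 1` vertices,
    -- form a basis of `W(1)_n`, the trees on `n` vertices form a basis of `M_n`, and adding a root
    -- is a bijection between these forests and these trees, hence a linear isomorphism from `W(1)`
    -- to `M` that maps `W(1)_n` onto `M_n`
    (∀ (r : RTree → RTree → Prop) [DecidableRel r] [IsTrans RTree r] [Std.Antisymm r]
        [Std.Total r],
      (∀ n : ℕ,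
        LinearIndependent ℂ
          (fun F : {F : Forest // forestSize F + 1 = n} => forestVector r 1 F.1) ∧
        Submodule.span ℂ (Set.range
          (fun F : {F : Forest // forestSize F + 1 = n} => forestVector r 1 F.1)) =
            weightSpace (Verma 1) n ∧
        LinearIndependent ℂ
          (fun t : {t : RTree // RTree.size t = n} => treeClass t.1) ∧
        Submodule.span ℂ (Set.range
          (fun t : {t : RTree // RTree.size t = n} => treeClass t.1)) = weightSpace TreeQuot n ∧
        Set.BijOn addRoot {F : Forest | forestSize F + 1 = n} {t : RTree | RTree.size t = n}) ∧
      ∃ e : Verma 1 ≃ₗ[ℂ] TreeQuot,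
        (∀ F : Forest, e (forestVector r 1 F) = treeClass (addRoot F)) ∧
        ∀ n : ℕ, (weightSpace (Verma 1) n).map (e : Verma 1 →ₗ[ℂ] TreeQuot) =
          weightSpace TreeQuot n) ∧
    -- `W(1)` is irreducible
    LieModule.IsIrreducible ℂ InsElim (Verma 1) := by
  obtain ⟨φ, hφ⟩ := exists_verma_hom (mem_weightSpace.1 isLowestWeightVector_vertex.2.1)
    isLowestWeightVector_vertex.2.2
  have hb := verma_hom_bijective hφ
  have hirr := treeQuot_isIrreducible
  refine ⟨⟨isLowestWeightVector_vertex, fun n hn w => not_isLowestWeightVector hn w⟩, hirr,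
    ⟨isLowestWeightVector_vermaVector, φ, hφ, fun ψ hψ => verma_hom_ext (hψ.trans hφ.symm), hb,
      fun n => map_weightSpace φ hb n⟩, ?_, isIrreducible_of_bijective φ hb⟩
  intro r _ _ _ _
  refine ⟨fun n => ?_, exists_linearEquiv_forestVector r⟩
  have h1 := linearIndependent_and_span_eq_weightSpace _ _ (dElt_lie_forestBasis r) n
  have h2 := linearIndependent_and_span_eq_weightSpace _ _ dElt_lie_treeBasis n
  simp only [forestBasis_apply] at h1
  simp only [treeBasis_apply] at h2
  exact ⟨h1.1, h1.2, h2.1, h2.2, bijOn_addRoot n⟩
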